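/- Let $M$ be a von Neumann algebra on a complex Hilbert space, with predual $M_*$ (the normal functionals on $M$, with the dual norm), and let $(M,\Delta)$ be a von Neumann algebraic compact quantum group: $\Delta : M\to M\,\overline{\otimes}\,M$ is a normal unital $*$-homomorphism with $(\Delta\,\overline{\otimes}\,\mathrm{id})\Delta=(\mathrm{id}\,\overline{\otimes}\,\Delta)\Delta$, and there is a Haar state, i.e. a faithful normal state $h$ on $M$ with $(h\,\overline{\otimes}\,\mathrm{id})\Delta(x)=(\mathrm{id}\,\overline{\otimes}\,h)\Delta(x)=h(x)1$ for all $x\in M$. For $\phi,\psi\in M_*$ put $\phi\star\psi=(\phi\,\overline{\otimes}\,\psi)\Delta\in M_*$ and let $T_\phi=(\mathrm{id}\,\overline{\otimes}\,\phi)\Delta : M\to M$ be the convolution operator associated with $\phi$. Let $\phi\in M_*$ and let $(\phi_i)$ be a net in $M_*$. Then: (i) if $\phi\ge 0$ then $T_\phi$ is completely positive; if $\phi(1)=1$ then $T_\phi(1)=1$; (ii) $T_\phi$ is normal (ultraweakly continuous), and it is decomposable, i.e. a linear combination of completely positive maps $M\to M$; (iii) the product $\star$ on $M_*$ is bilinear,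 associative and submultiplicative for the norm, and $\phi\mapsto T_\phi$ is a contractive algebra homomorphism from $(M_*,\star)$ to the bounded operators $B(M)$: it is linear, $\|T_\phi\|\le\|\phi\|$ and $T_{\phi\star\psi}=T_\phi T_\psi$ for all $\phi,\psi\in M_*$; (iv) $h\circ T_\phi=\phi(1)h$; (v) if $\phi_i\to\phi$ in norm, then $T_{\phi_i}\to T_\phi$ in the operator norm of $B(M)$; (vi) if $\phi_i\to\phi$ weakly, i.e. $\phi_i(x)\to\phi(x)$ for all $x\in M$, then $T_{\phi_i}(x)\to T_\phi(x)$ in the weak$^*$-topology $\sigma(M,M_*)$ for every $x\in M$. -/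

import Mathlib

open scoped TensorProduct InnerProductSpace ComplexOrder Topology CStarAlgebra

set_option linter.unusedSectionVars false

noncomputable section

namespace VNGroup

variable {H K L : Type*}
  [NormedAddCommGroup H] [InnerProductSpace ℂ H] [CompleteSpace H]
  [NormedAddCommGroup K] [InnerProductSpace ℂ K] [CompleteSpace K]
  [NormedAddCommGroup L] [InnerProductSpace ℂ L] [CompleteSpace L]

instance instSMulMemClass : SMulMemClass (VonNeumannAlgebra H) ℂ (H →L[ℂ] H) where
  smul_mem {S} r _ hx := S.toStarSubalgebra.smul_mem hx r

instance instIsClosed (M : VonNeumannAlgebra H) : IsClosed (M : Set (H →L[ℂ] H)) := by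
  rw [← M.centralizer_centralizer]
  exact Set.isClosed_centralizer _


/-- A von Neumann algebra, with the order inherited from the Loewner order of the bounded
operators, is a star-ordered ring: the positive elements are those of the form `star s * s`. -/
instance instStarOrderedRing (M : VonNeumannAlgebra H) : StarOrderedRing M := by
  refine StarOrderedRing.of_nonneg_iff' (fun {x y} h z => ?_) (fun x => ?_)
  · have : (x : H →L[ℂ] H) ≤ y := h
    exact add_le_add_right this (z : H →L[ℂ] H)
  · constructor
    · intro hx
      have hx' : (0 : H →L[ℂ] H) ≤ x := hx
      refine ⟨⟨CFC.sqrt (x : H →L[ℂ] H), ?_⟩, ?_⟩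
      · rw [← SetLike.mem_coe, ← M.centralizer_centralizer]
        intro b hb
        have : Commute (x : H →L[ℂ] H) b := hb _ x.2
        exact ((this.cfcₙ_nnreal _).symm).eq
      · ext1
        have hs : IsSelfAdjoint (CFC.sqrt (x : H →L[ℂ] H)) := (CFC.sqrt_nonneg _).isSelfAdjoint
        show (x : H →L[ℂ] H) = star (CFC.sqrt (x : H →L[ℂ] H)) * CFC.sqrt (x : H →L[ℂ] H)
        rw [hs.star_eq, CFC.sqrt_mul_sqrt_self _ hx']
    · rintro ⟨s, rfl⟩
      show (0 : H →L[ℂ] H) ≤ star (s : H →L[ℂ] H) * s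
      exact star_mul_self_nonneg _

/-- The Hilbert space tensor product, i.e. the completion of the algebraic tensor product. -/
abbrev HTensor (H K : Type*) [NormedAddCommGroup H] [InnerProductSpace ℂ H]
    [NormedAddCommGroup K] [InnerProductSpace ℂ K] : Type _ :=
  UniformSpace.Completion (H ⊗[ℂ] K)

/-- `creL K ξ η = ξ ⊗ η`. -/
def creL (K : Type*) [NormedAddCommGroup K] [InnerProductSpace ℂ K] :
    H →L[ℂ] K →L[ℂ] HTensor H K :=
  (ContinuousLinearMap.compL ℂ K (H ⊗[ℂ] K) (HTensor H K)
    UniformSpace.Completion.toComplL).comp (TensorProduct.mkL ℂ H K)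

/-- `creR H η ξ = ξ ⊗ η`. -/
def creR (H : Type*) [NormedAddCommGroup H] [InnerProductSpace ℂ H] :
    K →L[ℂ] H →L[ℂ] HTensor H K := (creL (H := H) K).flip


/-- The operator `a ⊗ b` on the Hilbert space tensor product. -/
def opTensor (a : H →L[ℂ] H) (b : K →L[ℂ] K) : HTensor H K →L[ℂ] HTensor H K :=
  (TensorProduct.mapL a b).completion



theorem exists_star_mul_self_eq {A : Type*} [CStarAlgebra A] [PartialOrder A] [StarOrderedRing A]
    (a : A) : ∃ c : A, algebraMap ℝ A (‖a‖ ^ 2) - star a * a = star c * c :=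
  CStarAlgebra.nonneg_iff_eq_star_mul_self.1
    (sub_nonneg.2 CStarAlgebra.star_mul_le_algebraMap_norm_sq)

theorem ofReal_norm_sq {E : Type*} [NormedAddCommGroup E] [InnerProductSpace ℂ E] (x : E) :
    ((‖x‖ ^ 2 : ℝ) : ℂ) = ⟪x, x⟫_ℂ := by
  rw [inner_self_eq_norm_sq_to_K]
  push_cast
  rfl

/-- A star homomorphism is completely contractive (in the form that is needed below). -/
theorem map_sum_le {n : ℕ} {M : VonNeumannAlgebra H} (S : M →⋆ₐ[ℂ] (K →L[ℂ] K))
    (A : CStarMatrix (Fin n) (Fin n) M) (ξ ξ' : Fin n → K) :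
    ‖∑ i, ∑ j, ⟪ξ i, S (A i j) (ξ' j)⟫_ℂ‖ ≤
      ‖A‖ * √(∑ i, ‖ξ i‖ ^ 2) * √(∑ i, ‖ξ' i‖ ^ 2) := by
  have key : ∑ i, ‖∑ j, S (A i j) (ξ' j)‖ ^ 2 ≤ ‖A‖ ^ 2 * ∑ i, ‖ξ' i‖ ^ 2 := by
    obtain ⟨C, hC⟩ : ∃ C : CStarMatrix (Fin n) (Fin n) M,
        algebraMap ℝ (CStarMatrix (Fin n) (Fin n) M) (‖A‖ ^ 2) - star A * A = star C * C :=
      exists_star_mul_self_eq A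
    have hgen : ∀ B : CStarMatrix (Fin n) (Fin n) M,
        ∑ i, ∑ j, ⟪ξ' i, S ((star B * B) i j) (ξ' j)⟫_ℂ =
          ((∑ i, ‖∑ j, S (B i j) (ξ' j)‖ ^ 2 : ℝ) : ℂ) := by
      intro B
      have h1 : ∀ k, ((‖∑ j, S (B k j) (ξ' j)‖ ^ 2 : ℝ) : ℂ) =
          ∑ i, ∑ j, ⟪ξ' i, S (star (B k i) * B k j) (ξ' j)⟫_ℂ := by
        intro k
        rw [ofReal_norm_sq]
        simp only [sum_inner, inner_sum, map_mul, map_star]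
        rw [Finset.sum_comm]
        refine Finset.sum_congr rfl fun i _ => Finset.sum_congr rfl fun j _ => ?_
        rw [mul_apply_eq_comp, ContinuousLinearMap.star_eq_adjoint,
          ContinuousLinearMap.adjoint_inner_right]
      rw [Complex.ofReal_sum]
      simp only [h1]
      conv_rhs => rw [Finset.sum_comm]
      refine Finset.sum_congr rfl fun i _ => ?_
      conv_rhs => rw [Finset.sum_comm]
      refine Finset.sum_congr rfl fun j _ => ?_
      rw [CStarMatrix.mul_apply, map_sum, sum_apply, inner_sum]
      rfl
    have e1 := hgen A
    have e2 := hgen C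
    rw [← hC] at e2
    have e3 : ∑ i, ∑ j, ⟪ξ' i, S ((algebraMap ℝ (CStarMatrix (Fin n) (Fin n) M) (‖A‖ ^ 2)) i j)
        (ξ' j)⟫_ℂ = ((‖A‖ ^ 2 * ∑ i, ‖ξ' i‖ ^ 2 : ℝ) : ℂ) := by
      have : ∀ i j, (algebraMap ℝ (CStarMatrix (Fin n) (Fin n) M) (‖A‖ ^ 2)) i j =
          if i = j then (((‖A‖ ^ 2 : ℝ) : ℂ)) • (1 : M) else 0 := by
        intro i j
        rw [Algebra.algebraMap_eq_smul_one, CStarMatrix.smul_apply, CStarMatrix.one_apply]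
        split_ifs
        · exact (Complex.coe_smul _ _).symm
        · simp
      simp only [this]
      have h2 : ∀ i, ∑ j, ⟪ξ' i, S (if i = j then (((‖A‖ ^ 2 : ℝ) : ℂ)) • (1 : M) else 0) (ξ' j)⟫_ℂ
          = ((‖A‖ ^ 2 * ‖ξ' i‖ ^ 2 : ℝ) : ℂ) := by
        intro i
        rw [Finset.sum_eq_single i]
        · rw [if_pos rfl, map_smul, map_one, smul_apply,
            one_apply_eq_self, inner_smul_right, inner_self_eq_norm_sq_to_K]
          push_cast
          rfl
        · intro j _ hj
          rw [if_neg (Ne.symm hj)]; simp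
        · simp
      simp only [h2]
      rw [← Complex.ofReal_sum, Finset.mul_sum]
    have e4 : (∑ i, ‖∑ j, S (C i j) (ξ' j)‖ ^ 2 : ℝ) =
        ‖A‖ ^ 2 * ∑ i, ‖ξ' i‖ ^ 2 - ∑ i, ‖∑ j, S (A i j) (ξ' j)‖ ^ 2 := by
      apply Complex.ofReal_injective
      rw [← e2, Complex.ofReal_sub, ← e1, ← e3]
      simp only [CStarMatrix.sub_apply, map_sub, sub_apply, inner_sub_right,
        Finset.sum_sub_distrib]
    have : 0 ≤ (∑ i, ‖∑ j, S (C i j) (ξ' j)‖ ^ 2 : ℝ) := by positivity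
    linarith
  calc ‖∑ i, ∑ j, ⟪ξ i, S (A i j) (ξ' j)⟫_ℂ‖
      = ‖∑ i, ⟪ξ i, ∑ j, S (A i j) (ξ' j)⟫_ℂ‖ := by simp only [inner_sum]
    _ ≤ ∑ i, ‖ξ i‖ * ‖∑ j, S (A i j) (ξ' j)‖ :=
        (norm_sum_le _ _).trans (Finset.sum_le_sum fun i _ => norm_inner_le_norm _ _)
    _ ≤ √(∑ i, ‖ξ i‖ ^ 2) * √(∑ i, ‖∑ j, S (A i j) (ξ' j)‖ ^ 2) :=
        Real.sum_mul_le_sqrt_mul_sqrt _ _ _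
    _ ≤ √(∑ i, ‖ξ i‖ ^ 2) * √(‖A‖ ^ 2 * ∑ i, ‖ξ' i‖ ^ 2) := by gcongr
    _ = ‖A‖ * √(∑ i, ‖ξ i‖ ^ 2) * √(∑ i, ‖ξ' i‖ ^ 2) := by
        rw [Real.sqrt_mul (by positivity), Real.sqrt_sq (norm_nonneg _)]; ring

theorem exists_orthonormal_rep (u v : K ⊗[ℂ] L) : ∃ (n : ℕ) (e : Fin n → L) (ξ ξ' : Fin n → K),
    Orthonormal ℂ e ∧ u = ∑ i, ξ i ⊗ₜ e i ∧ v = ∑ i, ξ' i ⊗ₜ e i := by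
  obtain ⟨K', L', _, hL', hs⟩ := TensorProduct.exists_finite_submodule_of_setFinite
    ({u, v} : Set (K ⊗[ℂ] L)) (by simp)
  have : FiniteDimensional ℂ L' := hL'
  let e := stdOrthonormalBasis ℂ L'
  have key : ∀ w : K' ⊗[ℂ] L', ∃ ξ : Fin (Module.finrank ℂ L') → K,
      TensorProduct.mapIncl K' L' w = ∑ i, ξ i ⊗ₜ[ℂ] ((e i : L') : L) := by
    intro w
    induction w with
    | zero => exact ⟨0, by simp⟩
    | add a b ha hb =>
      obtain ⟨x, hx⟩ := ha
      obtain ⟨z, hz⟩ := hb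
      exact ⟨x + z, by
        simp only [map_add, hx, hz, Pi.add_apply, TensorProduct.add_tmul, Finset.sum_add_distrib]⟩
    | tmul x z =>
      refine ⟨fun i => ⟪e i, z⟫_ℂ • (x : K), ?_⟩
      have hz : (z : L) = ∑ i, ⟪e i, z⟫_ℂ • ((e i : L') : L) := by
        conv_lhs => rw [← e.sum_repr' z]
        simp
      conv_lhs => rw [TensorProduct.mapIncl, TensorProduct.map_tmul, Submodule.subtype_apply,
        Submodule.subtype_apply, hz, TensorProduct.tmul_sum]
      simp only [TensorProduct.tmul_smul, TensorProduct.smul_tmul']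
  obtain ⟨u', hu⟩ := hs (Set.mem_insert _ _)
  obtain ⟨v', hv⟩ := hs (Set.mem_insert_of_mem _ rfl)
  obtain ⟨ξ, h1⟩ := key u'
  obtain ⟨ξ', h2⟩ := key v'
  exact ⟨_, fun i => ((e i : L') : L), ξ, ξ', e.orthonormal.comp_linearIsometry L'.subtypeₗᵢ,
    by rw [← hu, h1], by rw [← hv, h2]⟩

theorem norm_sq_orthonormal_rep {n : ℕ} {e : Fin n → L} (he : Orthonormal ℂ e) (ξ : Fin n → K) :
    ‖(∑ i, ξ i ⊗ₜ[ℂ] e i : K ⊗[ℂ] L)‖ = √(∑ i, ‖ξ i‖ ^ 2) := by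
  rw [eq_comm, Real.sqrt_eq_iff_eq_sq (by positivity) (norm_nonneg _)]
  apply Complex.ofReal_injective
  rw [ofReal_norm_sq, Complex.ofReal_sum]
  simp only [sum_inner, inner_sum, TensorProduct.inner_tmul, orthonormal_iff_ite.1 he]
  refine Finset.sum_congr rfl fun i _ => ?_
  simp [inner_self_eq_norm_sq_to_K]


section forms

variable {E : Type*} [NormedAddCommGroup E] [InnerProductSpace ℂ E]

/-- The bounded operator `T` with `⟪u, T v⟫ = B u v`, for a bounded sesquilinear form `B`. -/
def formOp [CompleteSpace E] (B : E →ₗ⋆[ℂ] E →ₗ[ℂ] ℂ) (C : ℝ)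
    (hB : ∀ u v, ‖B u v‖ ≤ C * ‖u‖ * ‖v‖) : E →L[ℂ] E :=
  ContinuousLinearMap.adjoint
    (InnerProductSpace.continuousLinearMapOfBilin (B.mkContinuous₂ C hB))

theorem inner_formOp [CompleteSpace E] (B : E →ₗ⋆[ℂ] E →ₗ[ℂ] ℂ) (C : ℝ)
    (hB : ∀ u v, ‖B u v‖ ≤ C * ‖u‖ * ‖v‖) (u v : E) : ⟪u, formOp B C hB v⟫_ℂ = B u v := by
  rw [formOp, ContinuousLinearMap.adjoint_inner_right,
    InnerProductSpace.continuousLinearMapOfBilin_apply]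
  rfl

theorem norm_formOp_le [CompleteSpace E] (B : E →ₗ⋆[ℂ] E →ₗ[ℂ] ℂ) (C : ℝ) (hC : 0 ≤ C)
    (hB : ∀ u v, ‖B u v‖ ≤ C * ‖u‖ * ‖v‖) : ‖formOp B C hB‖ ≤ C := by
  refine ContinuousLinearMap.opNorm_le_bound _ hC fun v => ?_
  rcases (norm_nonneg (formOp B C hB v)).eq_or_lt with h | h
  · rw [← h]; positivity
  · refine le_of_mul_le_mul_left ?_ h
    have h1 := hB (formOp B C hB v) v
    rw [← inner_formOp B C hB, ← ofReal_norm_sq, Complex.norm_real, norm_pow, norm_norm] at h1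
    nlinarith [h1]

/-- Auxiliary to `extFormOp`: the vector representing the functional `B u`. -/
def extFormVec (B : E →ₗ⋆[ℂ] E →ₗ[ℂ] ℂ) (C : ℝ) (hB : ∀ u v, ‖B u v‖ ≤ C * ‖u‖ * ‖v‖) :
    E →L[ℂ] UniformSpace.Completion E :=
  LinearMap.mkContinuous
    { toFun := fun u => (InnerProductSpace.toDual ℂ (UniformSpace.Completion E)).symm
        ((B.mkContinuous₂ C hB u).fromCompletion)
      map_add' := fun u v => by
        rw [← map_add]; congr 1
        refine ContinuousLinearMap.ext fun x => ?_
        induction x using UniformSpace.Completion.induction_on with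
        | hp => exact isClosed_eq (by fun_prop) (by fun_prop)
        | ih x => simp
      map_smul' := fun c u => by
        rw [RingHom.id_apply, ← Complex.conj_conj c, ← map_smulₛₗ, Complex.conj_conj]; congr 1
        refine ContinuousLinearMap.ext fun x => ?_
        induction x using UniformSpace.Completion.induction_on with
        | hp => exact isClosed_eq (by fun_prop) (by fun_prop)
        | ih x => simp }
    |C| (fun u => by
      simp only [LinearMap.coe_mk, AddHom.coe_mk, LinearIsometryEquiv.norm_map]
      refine ContinuousLinearMap.opNorm_le_bound _ (by positivity) fun x => ?_
      induction x using UniformSpace.Completion.induction_on with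
      | hp => exact isClosed_le (by fun_prop) (by fun_prop)
      | ih x =>
        simp only [ContinuousLinearMap.fromCompletion_apply_coe, UniformSpace.Completion.norm_coe]
        refine (hB u x).trans ?_
        gcongr
        exact le_abs_self C)

/-- The bounded operator `T` on the completion of `E` with `⟪u, T v⟫ = B u v` for `u v : E`, for a
bounded sesquilinear form `B` on `E`. -/
def extFormOp (B : E →ₗ⋆[ℂ] E →ₗ[ℂ] ℂ) (C : ℝ) (hB : ∀ u v, ‖B u v‖ ≤ C * ‖u‖ * ‖v‖) :
    UniformSpace.Completion E →L[ℂ] UniformSpace.Completion E :=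
  ContinuousLinearMap.adjoint (extFormVec B C hB).fromCompletion

theorem inner_extFormOp (B : E →ₗ⋆[ℂ] E →ₗ[ℂ] ℂ) (C : ℝ)
    (hB : ∀ u v, ‖B u v‖ ≤ C * ‖u‖ * ‖v‖) (u v : E) :
    ⟪(u : UniformSpace.Completion E), extFormOp B C hB v⟫_ℂ = B u v := by
  rw [extFormOp, ContinuousLinearMap.adjoint_inner_right,
    ContinuousLinearMap.fromCompletion_apply_coe]
  simp [extFormVec, InnerProductSpace.toDual_symm_apply]

end forms

section compression

variable {X : Type*} [NormedAddCommGroup X] [InnerProductSpace ℂ X] [CompleteSpace X]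

open ContinuousLinearMap in
/-- The sesquilinear map `(η, η') ↦ (R η)† y (R η')`, with values in `M`. -/
def compression (M : VonNeumannAlgebra H) (R : L →L[ℂ] H →L[ℂ] X) (y : X →L[ℂ] X)
    (h : ∀ η η', adjoint (R η) ∘L y ∘L R η' ∈ M) : L →ₗ⋆[ℂ] L →ₗ[ℂ] M :=
  LinearMap.mk₂'ₛₗ (starRingEnd ℂ) (RingHom.id ℂ)
    (fun η η' => ⟨adjoint (R η) ∘L y ∘L R η', h η η'⟩)
    (fun a b c => Subtype.ext <| by
      change _ = (adjoint (R a) ∘L y ∘L R c) + (adjoint (R b) ∘L y ∘L R c)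
      ext; simp)
    (fun a b c => Subtype.ext <| by
      change _ = (starRingEnd ℂ a) • (adjoint (R b) ∘L y ∘L R c)
      ext; simp [LinearIsometryEquiv.map_smulₛₗ])
    (fun a b c => Subtype.ext <| by
      change _ = (adjoint (R a) ∘L y ∘L R b) + (adjoint (R a) ∘L y ∘L R c)
      ext; simp)
    (fun a b c => Subtype.ext <| by
      change _ = (RingHom.id ℂ a) • (adjoint (R b) ∘L y ∘L R c)
      ext; simp)

open ContinuousLinearMap in
theorem norm_compression_matrix_le (M : VonNeumannAlgebra H) (R : L →L[ℂ] H →L[ℂ] X)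
    (hR : ∀ η η', adjoint (R η) ∘L R η' = ⟪η, η'⟫_ℂ • 1) (y : X →L[ℂ] X)
    (h : ∀ η η', adjoint (R η) ∘L y ∘L R η' ∈ M) {n : ℕ} {e : Fin n → L}
    (he : Orthonormal ℂ e) :
    ‖CStarMatrix.ofMatrix (Matrix.of fun i j => compression M R y h (e i) (e j))‖ ≤ ‖y‖ := by
  have key : ∀ v : WithCStarModule M (Fin n → M),
      ‖∑ i, R (e i) ∘L star ((v i : M) : H →L[ℂ] H)‖ = ‖v‖ := by
    intro v
    rw [← sq_eq_sq₀ (norm_nonneg _) (norm_nonneg _), sq, ← norm_adjoint_comp_self,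
      CStarModule.norm_sq_eq M, WithCStarModule.pi_inner]
    change _ = ‖((∑ i, ⟪v i, v i⟫_M : M) : H →L[ℂ] H)‖
    congr 1
    rw [AddSubmonoidClass.coe_finsetSum]
    simp only [WithCStarModule.inner_def, map_sum, adjoint_comp, comp_finsetSum, finsetSum_comp]
    refine Finset.sum_congr rfl fun i _ => ?_
    rw [Finset.sum_eq_single i]
    · rw [comp_assoc, ← comp_assoc (adjoint (R (e i))), hR, orthonormal_iff_ite.1 he, if_pos rfl,
        one_smul, ← star_eq_adjoint, star_star]
      rfl
    · intro j _ hj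
      rw [comp_assoc, ← comp_assoc (adjoint (R (e j))), hR, orthonormal_iff_ite.1 he, if_neg hj]
      simp
    · simp
  refine CStarMatrix.norm_le_of_forall_inner_le (C := ‖y‖₊) fun v w => ?_
  have : ‖⟪w, CStarMatrix.toCLM (CStarMatrix.ofMatrix
        (Matrix.of fun i j => compression M R y h (e i) (e j))) v⟫_M‖ =
      ‖adjoint (∑ i, R (e i) ∘L star ((v i : M) : H →L[ℂ] H)) ∘L y ∘L
        (∑ i, R (e i) ∘L star ((w i : M) : H →L[ℂ] H))‖ := by
    rw [WithCStarModule.pi_inner, CStarMatrix.toCLM_apply_eq_sum]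
    change ‖((∑ i, ⟪w i, ∑ j, v j * _⟫_M : M) : H →L[ℂ] H)‖ = _
    congr 1
    rw [AddSubmonoidClass.coe_finsetSum]
    simp only [WithCStarModule.inner_def, map_sum, adjoint_comp, comp_finsetSum, finsetSum_comp,
      Finset.sum_mul]
    refine Finset.sum_congr rfl fun i _ => ?_
    rw [AddSubmonoidClass.coe_finsetSum]
    refine Finset.sum_congr rfl fun j _ => ?_
    rw [← star_eq_adjoint, star_star]
    rfl
  rw [this]
  calc _ ≤ ‖adjoint (∑ i, R (e i) ∘L star ((v i : M) : H →L[ℂ] H))‖ * (‖y‖ *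
        ‖(∑ i, R (e i) ∘L star ((w i : M) : H →L[ℂ] H))‖) :=
        (opNorm_comp_le _ _).trans (by gcongr; exact opNorm_comp_le _ _)
    _ = ‖y‖ * ‖v‖ * ‖w‖ := by
        rw [LinearIsometryEquiv.norm_map, key, key]; ring

end compression

section tensor

open ContinuousLinearMap

theorem HTensor.ext_inner {T T' : HTensor H K →L[ℂ] HTensor H K}
    (h : ∀ (ξ ξ' : H) (η η' : K), ⟪creL K ξ η, T (creL K ξ' η')⟫_ℂ =
      ⟪creL K ξ η, T' (creL K ξ' η')⟫_ℂ) : T = T' := by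
  refine ContinuousLinearMap.ext fun v => ?_
  refine ext_inner_left ℂ fun u => ?_
  induction v using UniformSpace.Completion.induction_on with
  | hp => exact isClosed_eq (by fun_prop) (by fun_prop)
  | ih v =>
  induction u using UniformSpace.Completion.induction_on with
  | hp => exact isClosed_eq (by fun_prop) (by fun_prop)
  | ih u =>
  induction v with
  | zero => rw [UniformSpace.Completion.coe_zero]; simp
  | add a b ha hb => simp only [UniformSpace.Completion.coe_add, map_add, inner_add_right, ha, hb]
  | tmul ξ' η' =>
  induction u with
  | zero => rw [UniformSpace.Completion.coe_zero]; simp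
  | add a b ha hb => simp only [UniformSpace.Completion.coe_add, inner_add_left, ha, hb]
  | tmul ξ η => exact h ξ ξ' η η'

theorem inner_creL (ξ ξ' : H) (η η' : K) :
    ⟪creL K ξ η, creL K ξ' η'⟫_ℂ = ⟪ξ, ξ'⟫_ℂ * ⟪η, η'⟫_ℂ := by
  change ⟪((ξ ⊗ₜ[ℂ] η : H ⊗[ℂ] K) : HTensor H K), ((ξ' ⊗ₜ[ℂ] η' : H ⊗[ℂ] K) : HTensor H K)⟫_ℂ = _
  rw [UniformSpace.Completion.inner_coe, TensorProduct.inner_tmul]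

theorem creR_apply (ξ : H) (η : K) : creR H η ξ = creL K ξ η := rfl

theorem opTensor_creL (a : H →L[ℂ] H) (b : K →L[ℂ] K) (ξ : H) (η : K) :
    opTensor a b (creL K ξ η) = creL K (a ξ) (b η) := by
  change opTensor a b ((ξ ⊗ₜ[ℂ] η : H ⊗[ℂ] K) : HTensor H K) = _
  rw [opTensor, ContinuousLinearMap.completion_apply_coe, TensorProduct.mapL_tmul]
  rfl

theorem adjoint_opTensor (a : H →L[ℂ] H) (b : K →L[ℂ] K) :
    adjoint (opTensor a b) = opTensor (adjoint a) (adjoint b) := by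
  refine HTensor.ext_inner fun ξ ξ' η η' => ?_
  rw [adjoint_inner_right, opTensor_creL, opTensor_creL, inner_creL, inner_creL,
    adjoint_inner_right, adjoint_inner_right]

theorem opTensor_mul (a a' : H →L[ℂ] H) (b b' : K →L[ℂ] K) :
    opTensor a b * opTensor a' b' = opTensor (a * a') (b * b') := by
  refine HTensor.ext_inner fun ξ ξ' η η' => ?_
  rw [mul_apply_eq_comp, opTensor_creL, opTensor_creL, opTensor_creL]
  rfl

theorem adjoint_creL_comp (ξ ξ' : H) :
    adjoint (creL K ξ) ∘L creL K ξ' = ⟪ξ, ξ'⟫_ℂ • (1 : K →L[ℂ] K) := by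
  refine ContinuousLinearMap.ext fun η' => ext_inner_left ℂ fun η => ?_
  rw [comp_apply, adjoint_inner_right, inner_creL, smul_apply, one_apply_eq_self, inner_smul_right]

theorem adjoint_creR_comp (η η' : K) :
    adjoint (creR H η) ∘L creR H η' = ⟪η, η'⟫_ℂ • (1 : H →L[ℂ] H) := by
  refine ContinuousLinearMap.ext fun ξ' => ext_inner_left ℂ fun ξ => ?_
  rw [comp_apply, adjoint_inner_right, creR_apply, creR_apply, inner_creL, smul_apply,
    one_apply_eq_self, inner_smul_right, mul_comm]

/-- The commutant of `S ∪ S†`. -/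
def commutantOf (S : Set (H →L[ℂ] H)) : VonNeumannAlgebra H where
  toStarSubalgebra := StarSubalgebra.centralizer ℂ S
  centralizer_centralizer' := by
    change Set.centralizer (Set.centralizer (S ∪ star S).centralizer) = (S ∪ star S).centralizer
    exact Set.centralizer_centralizer_centralizer _

/-- The von Neumann algebra generated by `S`: the bicommutant of `S ∪ S†`. -/
def generatedBy (S : Set (H →L[ℂ] H)) : VonNeumannAlgebra H := (commutantOf S).commutant

theorem mem_commutantOf {S : Set (H →L[ℂ] H)} {z : H →L[ℂ] H} :
    z ∈ commutantOf S ↔ ∀ g ∈ S, g * z = z * g ∧ star g * z = z * star g :=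
  StarSubalgebra.mem_centralizer_iff ℂ

theorem subset_generatedBy (S : Set (H →L[ℂ] H)) : S ⊆ generatedBy S := fun g hg => by
  refine VonNeumannAlgebra.mem_commutant_iff.2 fun z hz => ?_
  exact ((mem_commutantOf.1 hz g hg).1).symm

variable (M : VonNeumannAlgebra H) (N : VonNeumannAlgebra K)

/-- The von Neumann algebra tensor product `M ⊗̄ N` on the Hilbert space tensor product, generated
by the operators `a ⊗ b` with `a ∈ M` and `b ∈ N`. -/
def vnTensor : VonNeumannAlgebra (HTensor H K) :=
  generatedBy {z | ∃ a ∈ M, ∃ b ∈ N, z = opTensor a b}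

/-- The elementary tensor `a ⊗ b` in `M ⊗̄ N`. -/
def vnTmul (a : M) (b : N) : vnTensor M N :=
  ⟨opTensor (a : H →L[ℂ] H) (b : K →L[ℂ] K), subset_generatedBy _ ⟨a, a.2, b, b.2, rfl⟩⟩

variable {M N}

theorem vnTensor_commute {y : HTensor H K →L[ℂ] HTensor H K} (hy : y ∈ vnTensor M N)
    {a : H →L[ℂ] H} {b : K →L[ℂ] K} (ha : a ∈ M.commutant) (hb : b ∈ N.commutant) :
    opTensor a b * y = y * opTensor a b := by
  refine VonNeumannAlgebra.mem_commutant_iff.1 hy _ (mem_commutantOf.2 ?_)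
  rintro _ ⟨x, hx, z, hz, rfl⟩
  have ha' := VonNeumannAlgebra.mem_commutant_iff.1 ha
  have hb' := VonNeumannAlgebra.mem_commutant_iff.1 hb
  constructor
  · rw [opTensor_mul, opTensor_mul, ha' x hx, hb' z hz]
  · rw [star_eq_adjoint, adjoint_opTensor, opTensor_mul, opTensor_mul, ← star_eq_adjoint,
      ← star_eq_adjoint, ha' _ (star_mem hx), hb' _ (star_mem hz)]

theorem mem_of_commute {z : H →L[ℂ] H} (h : ∀ g ∈ M.commutant, g * z = z * g) : z ∈ M := by
  rw [← M.commutant_commutant]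
  exact VonNeumannAlgebra.mem_commutant_iff.2 h

theorem compL_mem (y : vnTensor M N) (ξ ξ' : H) :
    adjoint (creL K ξ) ∘L (y : HTensor H K →L[ℂ] HTensor H K) ∘L creL K ξ' ∈ N := by
  refine mem_of_commute fun g hg => ?_
  have hc := vnTensor_commute y.2 (one_mem M.commutant) hg
  refine ContinuousLinearMap.ext fun η' => ext_inner_left ℂ fun η => ?_
  have h1 := congrArg (fun T => ⟪creL K ξ η, T (creL K ξ' η')⟫_ℂ) hc
  simp only [mul_apply_eq_comp] at h1
  rw [← adjoint_inner_left, adjoint_opTensor, opTensor_creL, opTensor_creL, ← star_eq_adjoint,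
    star_one, one_apply_eq_self, one_apply_eq_self] at h1
  simp only [mul_apply_eq_comp, comp_apply]
  rw [← adjoint_inner_left g, adjoint_inner_right, adjoint_inner_right]
  exact h1

theorem compR_mem (y : vnTensor M N) (η η' : K) :
    adjoint (creR H η) ∘L (y : HTensor H K →L[ℂ] HTensor H K) ∘L creR H η' ∈ M := by
  refine mem_of_commute fun g hg => ?_
  have hc := vnTensor_commute y.2 hg (one_mem N.commutant)
  refine ContinuousLinearMap.ext fun ξ' => ext_inner_left ℂ fun ξ => ?_
  have h1 := congrArg (fun T => ⟪creL K ξ η, T (creL K ξ' η')⟫_ℂ) hc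
  simp only [mul_apply_eq_comp] at h1
  rw [← adjoint_inner_left, adjoint_opTensor, opTensor_creL, opTensor_creL,
    ← star_eq_adjoint (1 : K →L[ℂ] K), star_one, one_apply_eq_self, one_apply_eq_self] at h1
  simp only [mul_apply_eq_comp, comp_apply]
  rw [← adjoint_inner_left g, adjoint_inner_right, adjoint_inner_right]
  exact h1

/-- `compL y ξ ξ'` is `(ω_{ξ,ξ'} ⊗ id) y ∈ N`, where `ω_{ξ,ξ'}` is the vector functional
`a ↦ ⟪ξ, a ξ'⟫`. -/
def compL (y : vnTensor M N) : H →ₗ⋆[ℂ] H →ₗ[ℂ] N :=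
  compression N (creL K) (y : HTensor H K →L[ℂ] HTensor H K) (compL_mem y)

/-- `compR y η η'` is `(id ⊗ ω_{η,η'}) y ∈ M`, where `ω_{η,η'}` is the vector functional
`b ↦ ⟪η, b η'⟫`. -/
def compR (y : vnTensor M N) : K →ₗ⋆[ℂ] K →ₗ[ℂ] M :=
  compression M (creR H) (y : HTensor H K →L[ℂ] HTensor H K) (compR_mem y)

theorem norm_creL (ξ : H) : ‖creL K ξ‖ ≤ ‖ξ‖ :=
  opNorm_le_bound _ (norm_nonneg _) fun η => le_of_eq <| by
    change ‖((ξ ⊗ₜ[ℂ] η : H ⊗[ℂ] K) : HTensor H K)‖ = _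
    rw [UniformSpace.Completion.norm_coe, TensorProduct.norm_tmul]

theorem norm_creR (η : K) : ‖creR H η‖ ≤ ‖η‖ :=
  opNorm_le_bound _ (norm_nonneg _) fun ξ => le_of_eq <| by
    change ‖((ξ ⊗ₜ[ℂ] η : H ⊗[ℂ] K) : HTensor H K)‖ = _
    rw [UniformSpace.Completion.norm_coe, TensorProduct.norm_tmul, mul_comm]

theorem norm_compL_le (y : vnTensor M N) (ξ ξ' : H) : ‖compL y ξ ξ'‖ ≤ ‖y‖ * ‖ξ‖ * ‖ξ'‖ := by
  change ‖adjoint (creL K ξ) ∘L (y : HTensor H K →L[ℂ] HTensor H K) ∘L creL K ξ'‖ ≤ _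
  refine (opNorm_comp_le _ _).trans ((mul_le_mul_of_nonneg_left (opNorm_comp_le _ _)
    (norm_nonneg _)).trans ?_)
  rw [LinearIsometryEquiv.norm_map]
  calc _ ≤ ‖ξ‖ * (‖y‖ * ‖ξ'‖) := by
        gcongr
        · exact norm_creL ξ
        · exact le_rfl
        · exact norm_creL ξ'
    _ = _ := by ring

theorem norm_compR_le (y : vnTensor M N) (η η' : K) : ‖compR y η η'‖ ≤ ‖y‖ * ‖η‖ * ‖η'‖ := by
  change ‖adjoint (creR H η) ∘L (y : HTensor H K →L[ℂ] HTensor H K) ∘L creR H η'‖ ≤ _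
  refine (opNorm_comp_le _ _).trans ((mul_le_mul_of_nonneg_left (opNorm_comp_le _ _)
    (norm_nonneg _)).trans ?_)
  rw [LinearIsometryEquiv.norm_map]
  calc _ ≤ ‖η‖ * (‖y‖ * ‖η'‖) := by
        gcongr
        · exact norm_creR η
        · exact le_rfl
        · exact norm_creR η'
    _ = _ := by ring

end tensor

section maps

open ContinuousLinearMap

variable {M : VonNeumannAlgebra H} {N : VonNeumannAlgebra K}

/-- The scalar sesquilinear form obtained from `c` by applying `φ`. -/
def sliceForm (c : L →ₗ⋆[ℂ] L →ₗ[ℂ] N) (φ : StrongDual ℂ N) : L →ₗ⋆[ℂ] L →ₗ[ℂ] ℂ :=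
  LinearMap.mk₂'ₛₗ (starRingEnd ℂ) (RingHom.id ℂ) (fun u v => φ (c u v))
    (by simp) (by simp) (by simp) (by simp)

/-- The operator `(id ⊗ φ) y`, given by `⟪ξ, (id ⊗ φ) y ξ'⟫ = φ ((ω_{ξ,ξ'} ⊗ id) y)`. -/
def sliceRightOp (φ : StrongDual ℂ N) (y : vnTensor M N) : H →L[ℂ] H :=
  formOp (sliceForm (compL y) φ) (‖φ‖ * ‖y‖) fun u v => by
    calc ‖φ (compL y u v)‖ ≤ ‖φ‖ * ‖compL y u v‖ := φ.le_opNorm _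
      _ ≤ ‖φ‖ * (‖y‖ * ‖u‖ * ‖v‖) := by gcongr; exact norm_compL_le y u v
      _ = _ := by ring

theorem inner_sliceRightOp (φ : StrongDual ℂ N) (y : vnTensor M N) (ξ ξ' : H) :
    ⟪ξ, sliceRightOp φ y ξ'⟫_ℂ = φ (compL y ξ ξ') := inner_formOp _ _ _ _ _

/-- The operator `(φ ⊗ id) y`, given by `⟪η, (φ ⊗ id) y η'⟫ = φ ((id ⊗ ω_{η,η'}) y)`. -/
def sliceLeftOp (φ : StrongDual ℂ M) (y : vnTensor M N) : K →L[ℂ] K :=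
  formOp (sliceForm (compR y) φ) (‖φ‖ * ‖y‖) fun u v => by
    calc ‖φ (compR y u v)‖ ≤ ‖φ‖ * ‖compR y u v‖ := φ.le_opNorm _
      _ ≤ ‖φ‖ * (‖y‖ * ‖u‖ * ‖v‖) := by gcongr; exact norm_compR_le y u v
      _ = _ := by ring

theorem inner_sliceLeftOp (φ : StrongDual ℂ M) (y : vnTensor M N) (η η' : K) :
    ⟪η, sliceLeftOp φ y η'⟫_ℂ = φ (compR y η η') := inner_formOp _ _ _ _ _

theorem sliceRightOp_mem (φ : StrongDual ℂ N) (y : vnTensor M N) : sliceRightOp φ y ∈ M := by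
  refine mem_of_commute fun g hg => ?_
  have hc := vnTensor_commute y.2 hg (one_mem N.commutant)
  refine ContinuousLinearMap.ext fun ξ' => ext_inner_left ℂ fun ξ => ?_
  rw [mul_apply_eq_comp, mul_apply_eq_comp, ← adjoint_inner_left g, inner_sliceRightOp,
    inner_sliceRightOp]
  congr 1
  refine Subtype.ext (ContinuousLinearMap.ext fun η' => ext_inner_left ℂ fun η => ?_)
  have h1 := congrArg (fun T => ⟪creL K ξ η, T (creL K ξ' η')⟫_ℂ) hc
  simp only [mul_apply_eq_comp] at h1
  rw [← adjoint_inner_left, adjoint_opTensor, opTensor_creL, opTensor_creL,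
    ← star_eq_adjoint (1 : K →L[ℂ] K), star_one, one_apply_eq_self, one_apply_eq_self] at h1
  change ⟪η, adjoint (creL K (adjoint g ξ)) _⟫_ℂ = ⟪η, adjoint (creL K ξ) _⟫_ℂ
  rw [adjoint_inner_right, adjoint_inner_right]
  exact h1

theorem sliceLeftOp_mem (φ : StrongDual ℂ M) (y : vnTensor M N) : sliceLeftOp φ y ∈ N := by
  refine mem_of_commute fun g hg => ?_
  have hc := vnTensor_commute y.2 (one_mem M.commutant) hg
  refine ContinuousLinearMap.ext fun η' => ext_inner_left ℂ fun η => ?_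
  rw [mul_apply_eq_comp, mul_apply_eq_comp, ← adjoint_inner_left g, inner_sliceLeftOp,
    inner_sliceLeftOp]
  congr 1
  refine Subtype.ext (ContinuousLinearMap.ext fun ξ' => ext_inner_left ℂ fun ξ => ?_)
  have h1 := congrArg (fun T => ⟪creL K ξ η, T (creL K ξ' η')⟫_ℂ) hc
  simp only [mul_apply_eq_comp] at h1
  rw [← adjoint_inner_left, adjoint_opTensor, opTensor_creL, opTensor_creL, ← star_eq_adjoint,
    star_one, one_apply_eq_self, one_apply_eq_self] at h1
  change ⟪ξ, adjoint (creR H (adjoint g η)) _⟫_ℂ = ⟪ξ, adjoint (creR H η) _⟫_ℂ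
  rw [adjoint_inner_right, adjoint_inner_right]
  exact h1

theorem compL_add (y z : vnTensor M N) (ξ ξ' : H) :
    compL (y + z) ξ ξ' = compL y ξ ξ' + compL z ξ ξ' :=
  Subtype.ext <| ContinuousLinearMap.ext fun _ => map_add (adjoint (creL K ξ)) _ _

theorem compL_smul (c : ℂ) (y : vnTensor M N) (ξ ξ' : H) :
    compL (c • y) ξ ξ' = c • compL y ξ ξ' :=
  Subtype.ext <| ContinuousLinearMap.ext fun _ => map_smul (adjoint (creL K ξ)) _ _

theorem compR_add (y z : vnTensor M N) (η η' : K) :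
    compR (y + z) η η' = compR y η η' + compR z η η' :=
  Subtype.ext <| ContinuousLinearMap.ext fun _ => map_add (adjoint (creR H η)) _ _

theorem compR_smul (c : ℂ) (y : vnTensor M N) (η η' : K) :
    compR (c • y) η η' = c • compR y η η' :=
  Subtype.ext <| ContinuousLinearMap.ext fun _ => map_smul (adjoint (creR H η)) _ _

/-- The slice map `id ⊗̄ φ : M ⊗̄ N → M`. It satisfies `(id ⊗̄ φ) (a ⊗ b) = φ b • a`, and for
normal `φ` it is normal (see `sliceRight_vnTmul` and `isNormalMap_sliceRight`), so that it is the
unique normal extension of the algebraic slice map. -/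
def sliceRight (φ : StrongDual ℂ N) : vnTensor M N →L[ℂ] M :=
  LinearMap.mkContinuous
    { toFun := fun y => ⟨sliceRightOp φ y, sliceRightOp_mem φ y⟩
      map_add' := fun y z => Subtype.ext <| ContinuousLinearMap.ext fun ξ' =>
        ext_inner_left ℂ fun ξ => by
          change ⟪ξ, sliceRightOp φ (y + z) ξ'⟫_ℂ =
            ⟪ξ, sliceRightOp φ y ξ' + sliceRightOp φ z ξ'⟫_ℂ
          rw [inner_add_right, inner_sliceRightOp, inner_sliceRightOp, inner_sliceRightOp,
            compL_add, map_add]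
      map_smul' := fun c y => Subtype.ext <| ContinuousLinearMap.ext fun ξ' =>
        ext_inner_left ℂ fun ξ => by
          change ⟪ξ, sliceRightOp φ (c • y) ξ'⟫_ℂ = ⟪ξ, c • sliceRightOp φ y ξ'⟫_ℂ
          rw [inner_smul_right, inner_sliceRightOp, inner_sliceRightOp, compL_smul, map_smul,
            smul_eq_mul] }
    ‖φ‖ fun y => norm_formOp_le _ _ (by positivity) _

/-- The slice map `φ ⊗̄ id : M ⊗̄ N → N`, the mirror image of `sliceRight`. -/
def sliceLeft (φ : StrongDual ℂ M) : vnTensor M N →L[ℂ] N :=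
  LinearMap.mkContinuous
    { toFun := fun y => ⟨sliceLeftOp φ y, sliceLeftOp_mem φ y⟩
      map_add' := fun y z => Subtype.ext <| ContinuousLinearMap.ext fun η' =>
        ext_inner_left ℂ fun η => by
          change ⟪η, sliceLeftOp φ (y + z) η'⟫_ℂ =
            ⟪η, sliceLeftOp φ y η' + sliceLeftOp φ z η'⟫_ℂ
          rw [inner_add_right, inner_sliceLeftOp, inner_sliceLeftOp, inner_sliceLeftOp,
            compR_add, map_add]
      map_smul' := fun c y => Subtype.ext <| ContinuousLinearMap.ext fun η' =>
        ext_inner_left ℂ fun η => by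
          change ⟪η, sliceLeftOp φ (c • y) η'⟫_ℂ = ⟪η, c • sliceLeftOp φ y η'⟫_ℂ
          rw [inner_smul_right, inner_sliceLeftOp, inner_sliceLeftOp, compR_smul, map_smul,
            smul_eq_mul] }
    ‖φ‖ fun y => norm_formOp_le _ _ (by positivity) _

theorem compL_vnTmul (a : M) (b : N) (ξ ξ' : H) :
    compL (vnTmul M N a b) ξ ξ' = ⟪ξ, (a : H →L[ℂ] H) ξ'⟫_ℂ • b := by
  refine Subtype.ext (ContinuousLinearMap.ext fun η' => ext_inner_left ℂ fun η => ?_)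
  change ⟪η, adjoint (creL K ξ) (opTensor _ _ (creL K ξ' η'))⟫_ℂ =
    ⟪η, ⟪ξ, (a : H →L[ℂ] H) ξ'⟫_ℂ • (b : K →L[ℂ] K) η'⟫_ℂ
  rw [adjoint_inner_right, opTensor_creL, inner_creL, inner_smul_right]

theorem compR_vnTmul (a : M) (b : N) (η η' : K) :
    compR (vnTmul M N a b) η η' = ⟪η, (b : K →L[ℂ] K) η'⟫_ℂ • a := by
  refine Subtype.ext (ContinuousLinearMap.ext fun ξ' => ext_inner_left ℂ fun ξ => ?_)
  change ⟪ξ, adjoint (creR H η) (opTensor _ _ (creL K ξ' η'))⟫_ℂ =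
    ⟪ξ, ⟪η, (b : K →L[ℂ] K) η'⟫_ℂ • (a : H →L[ℂ] H) ξ'⟫_ℂ
  rw [adjoint_inner_right, opTensor_creL, creR_apply, inner_creL, inner_smul_right, mul_comm]

theorem sliceRight_vnTmul (φ : StrongDual ℂ N) (a : M) (b : N) :
    sliceRight φ (vnTmul M N a b) = φ b • a := by
  refine Subtype.ext (ContinuousLinearMap.ext fun ξ' => ext_inner_left ℂ fun ξ => ?_)
  change ⟪ξ, sliceRightOp φ _ ξ'⟫_ℂ = ⟪ξ, φ b • (a : H →L[ℂ] H) ξ'⟫_ℂ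
  rw [inner_sliceRightOp, compL_vnTmul, map_smul, inner_smul_right, smul_eq_mul, mul_comm]

theorem sliceLeft_vnTmul (φ : StrongDual ℂ M) (a : M) (b : N) :
    sliceLeft φ (vnTmul M N a b) = φ a • b := by
  refine Subtype.ext (ContinuousLinearMap.ext fun η' => ext_inner_left ℂ fun η => ?_)
  change ⟪η, sliceLeftOp φ _ η'⟫_ℂ = ⟪η, φ a • (b : K →L[ℂ] K) η'⟫_ℂ
  rw [inner_sliceLeftOp, compR_vnTmul, map_smul, inner_smul_right, smul_eq_mul, mul_comm]

variable {E : Type*} [NormedAddCommGroup E] [InnerProductSpace ℂ E] [CompleteSpace E]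
  {P : VonNeumannAlgebra E}

/-- The sesquilinear form `(ξ ⊗ η, ξ' ⊗ η') ↦ ⟪ξ, S (c η η') ξ'⟫` on the algebraic tensor product. -/
def ampForm (S : M →⋆ₐ[ℂ] P) (c : L →ₗ⋆[ℂ] L →ₗ[ℂ] M) :
    E ⊗[ℂ] L →ₗ⋆[ℂ] E ⊗[ℂ] L →ₗ[ℂ] ℂ :=
  TensorProduct.lift (LinearMap.mk₂'ₛₗ (starRingEnd ℂ) (starRingEnd ℂ)
    (fun ξ η => TensorProduct.lift (LinearMap.mk₂'ₛₗ (RingHom.id ℂ) (RingHom.id ℂ)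
      (fun ξ' η' => ⟪ξ, (S (c η η') : E →L[ℂ] E) ξ'⟫_ℂ)
      (by simp) (by simp) (by simp) (by simp)))
    (fun _ _ _ => TensorProduct.ext' fun _ _ => by simp)
    (fun _ _ _ => TensorProduct.ext' fun _ _ => by simp [mul_comm])
    (fun _ _ _ => TensorProduct.ext' fun _ _ => by simp)
    (fun _ _ _ => TensorProduct.ext' fun _ _ => by simp))

theorem ampForm_tmul (S : M →⋆ₐ[ℂ] P) (c : L →ₗ⋆[ℂ] L →ₗ[ℂ] M) (ξ ξ' : E) (η η' : L) :
    ampForm S c (ξ ⊗ₜ η) (ξ' ⊗ₜ η') = ⟪ξ, (S (c η η') : E →L[ℂ] E) ξ'⟫_ℂ := rfl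

theorem norm_ampForm_le (S : M →⋆ₐ[ℂ] P) (c : L →ₗ⋆[ℂ] L →ₗ[ℂ] M) (C : ℝ)
    (hc : ∀ (n : ℕ) (e : Fin n → L), Orthonormal ℂ e →
      ‖CStarMatrix.ofMatrix (Matrix.of fun i j => c (e i) (e j))‖ ≤ C) (u v : E ⊗[ℂ] L) :
    ‖ampForm S c u v‖ ≤ C * ‖u‖ * ‖v‖ := by
  obtain ⟨n, e, ξ, ξ', he, rfl, rfl⟩ := exists_orthonormal_rep u v
  rw [norm_sq_orthonormal_rep he, norm_sq_orthonormal_rep he]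
  have h := map_sum_le ((P.toStarSubalgebra.subtype : P →⋆ₐ[ℂ] (E →L[ℂ] E)).comp S)
    (CStarMatrix.ofMatrix (Matrix.of fun i j => c (e i) (e j))) ξ ξ'
  have h2 : ampForm S c (∑ i, ξ i ⊗ₜ[ℂ] e i) (∑ i, ξ' i ⊗ₜ[ℂ] e i) =
      ∑ i, ∑ j, ⟪ξ i, (S (c (e i) (e j)) : E →L[ℂ] E) (ξ' j)⟫_ℂ := by
    simp only [map_sum, LinearMap.sum_apply, ampForm_tmul]
    rw [Finset.sum_comm]
  rw [h2]
  refine h.trans ?_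
  gcongr
  exact hc n e he

/-- The operator `(S ⊗̄ id) y`, for a star homomorphism `S : M → P` and `y ∈ M ⊗̄ N`. It is the
operator whose slices by vector functionals are `(id ⊗ ω) ((S ⊗̄ id) y) = S ((id ⊗ ω) y)`. Slices by
vector functionals determine an operator, so for normal `S` this is the value at `y` of the unique
normal map with `a ⊗ b ↦ S a ⊗ b`. -/
def ampRight (S : M →⋆ₐ[ℂ] P) (y : vnTensor M N) : HTensor E K →L[ℂ] HTensor E K :=
  extFormOp (ampForm S (compR y)) ‖y‖ <| norm_ampForm_le S (compR y) ‖y‖ fun _ _ he =>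
    norm_compression_matrix_le M (creR H) adjoint_creR_comp _ (compR_mem y) he

/-- The operator `(id ⊗̄ S) y`, the mirror image of `ampRight`. -/
def ampLeft (S : N →⋆ₐ[ℂ] P) (y : vnTensor M N) : HTensor H E →L[ℂ] HTensor H E :=
  extFormOp (((ampForm S (compL y)).compl₂ (TensorProduct.comm ℂ H E).toLinearMap).comp
      (TensorProduct.comm ℂ H E).toLinearMap) ‖y‖ fun u v => by
    have := norm_ampForm_le S (compL y) ‖y‖ (fun _ _ he =>
      norm_compression_matrix_le N (creL K) adjoint_creL_comp _ (compL_mem y) he)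
      (TensorProduct.comm ℂ H E u) (TensorProduct.comm ℂ H E v)
    rwa [TensorProduct.norm_comm, TensorProduct.norm_comm] at this

theorem inner_ampRight (S : M →⋆ₐ[ℂ] P) (y : vnTensor M N) (ξ ξ' : E) (η η' : K) :
    ⟪creL K ξ η, ampRight S y (creL K ξ' η')⟫_ℂ = ⟪ξ, (S (compR y η η') : E →L[ℂ] E) ξ'⟫_ℂ :=
  inner_extFormOp _ _ _ (ξ ⊗ₜ η) (ξ' ⊗ₜ η')

theorem inner_ampLeft (S : N →⋆ₐ[ℂ] P) (y : vnTensor M N) (ξ ξ' : H) (η η' : E) :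
    ⟪creL E ξ η, ampLeft S y (creL E ξ' η')⟫_ℂ = ⟪η, (S (compL y ξ ξ') : E →L[ℂ] E) η'⟫_ℂ :=
  inner_extFormOp _ _ _ (ξ ⊗ₜ η) (ξ' ⊗ₜ η')

theorem ampRight_vnTmul (S : M →⋆ₐ[ℂ] P) (a : M) (b : N) :
    ampRight S (vnTmul M N a b) = opTensor (S a : E →L[ℂ] E) (b : K →L[ℂ] K) := by
  refine HTensor.ext_inner fun ξ ξ' η η' => ?_
  rw [inner_ampRight, compR_vnTmul, map_smul, opTensor_creL, inner_creL, mul_comm]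
  exact inner_smul_right _ _ _

theorem ampLeft_vnTmul (S : N →⋆ₐ[ℂ] P) (a : M) (b : N) :
    ampLeft S (vnTmul M N a b) = opTensor (a : H →L[ℂ] H) (S b : E →L[ℂ] E) := by
  refine HTensor.ext_inner fun ξ ξ' η η' => ?_
  rw [inner_ampLeft, compL_vnTmul, map_smul, opTensor_creL, inner_creL]
  exact inner_smul_right _ _ _

theorem denseRange_rTensor {A B : Type*} (L : Type*) [NormedAddCommGroup A] [InnerProductSpace ℂ A]
    [NormedAddCommGroup B] [InnerProductSpace ℂ B] [NormedAddCommGroup L] [InnerProductSpace ℂ L]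
    (f : A →ₗᵢ[ℂ] B) (hf : DenseRange f) : DenseRange (f.rTensor L) := by
  have h : (f.rTensor L).toLinearMap.range.topologicalClosure = ⊤ := by
    rw [eq_top_iff, ← TensorProduct.span_tmul_eq_top, Submodule.span_le]
    rintro _ ⟨b, l, rfl⟩
    have hc : IsClosed {b : B | b ⊗ₜ[ℂ] l ∈ (f.rTensor L).toLinearMap.range.topologicalClosure} :=
      IsClosed.preimage (f := fun b : B => b ⊗ₜ[ℂ] l)
        ((TensorProduct.mkL ℂ B L).flip l).continuous (Submodule.isClosed_topologicalClosure _)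
    exact hf.induction_on b hc fun a => Submodule.le_topologicalClosure _ ⟨a ⊗ₜ l, by simp⟩
  intro x
  have : x ∈ (f.rTensor L).toLinearMap.range.topologicalClosure := h ▸ Submodule.mem_top
  exact this

theorem denseRange_lTensor {A B : Type*} (L : Type*) [NormedAddCommGroup A] [InnerProductSpace ℂ A]
    [NormedAddCommGroup B] [InnerProductSpace ℂ B] [NormedAddCommGroup L] [InnerProductSpace ℂ L]
    (f : A →ₗᵢ[ℂ] B) (hf : DenseRange f) : DenseRange (f.lTensor L) := by
  have h : (f.lTensor L).toLinearMap.range.topologicalClosure = ⊤ := by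
    rw [eq_top_iff, ← TensorProduct.span_tmul_eq_top, Submodule.span_le]
    rintro _ ⟨l, b, rfl⟩
    have hc : IsClosed {b : B | l ⊗ₜ[ℂ] b ∈ (f.lTensor L).toLinearMap.range.topologicalClosure} :=
      IsClosed.preimage (f := fun b : B => l ⊗ₜ[ℂ] b)
        (TensorProduct.mkL ℂ L B l).continuous (Submodule.isClosed_topologicalClosure _)
    exact hf.induction_on b hc fun a => Submodule.le_topologicalClosure _ ⟨l ⊗ₜ a, by simp⟩
  intro x
  have : x ∈ (f.lTensor L).toLinearMap.range.topologicalClosure := h ▸ Submodule.mem_top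
  exact this

/-- The canonical unitary `(H ⊗ K) ⊗ L ≃ H ⊗ (K ⊗ L)`. -/
def assocH (H K L : Type*) [NormedAddCommGroup H] [InnerProductSpace ℂ H]
    [NormedAddCommGroup K] [InnerProductSpace ℂ K]
    [NormedAddCommGroup L] [InnerProductSpace ℂ L] :
    HTensor (HTensor H K) L ≃ₗᵢ[ℂ] HTensor H (HTensor K L) :=
  LinearEquiv.extendOfIsometry (TensorProduct.assoc ℂ H K L)
    ((UniformSpace.Completion.toComplₗᵢ.comp
      (UniformSpace.Completion.toComplₗᵢ.rTensor L)).toLinearMap)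
    ((UniformSpace.Completion.toComplₗᵢ.comp
      (UniformSpace.Completion.toComplₗᵢ.lTensor H)).toLinearMap)
    (UniformSpace.Completion.denseRange_coe.comp
      (denseRange_rTensor L _ UniformSpace.Completion.denseRange_coe)
      (UniformSpace.Completion.continuous_coe _))
    (UniformSpace.Completion.denseRange_coe.comp
      (denseRange_lTensor H _ UniformSpace.Completion.denseRange_coe)
      (UniformSpace.Completion.continuous_coe _))
    (fun x => by
      rw [LinearIsometry.coe_toLinearMap, LinearIsometry.norm_map, LinearIsometry.coe_toLinearMap,
        LinearIsometry.norm_map]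
      exact TensorProduct.norm_assoc x)

theorem assocH_creL (ξ : H) (η : K) (ζ : L) :
    assocH H K L (creL L (creL K ξ η) ζ) = creL (HTensor K L) ξ (creL L η ζ) :=
  LinearEquiv.extendOfIsometry_eq _ _ _ _ _ _ ((ξ ⊗ₜ[ℂ] η) ⊗ₜ[ℂ] ζ)

end maps

section predual

open ContinuousLinearMap

variable (M : VonNeumannAlgebra H) {N : VonNeumannAlgebra K}

/-- A functional on `M` is normal (ultraweakly continuous) if it is of the form
`x ↦ ∑ n, ⟪ξ n, x (ξ' n)⟫` with square-summable sequences of vectors `ξ n`, `ξ' n`. -/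
def IsNormalFunctional {M : VonNeumannAlgebra H} (φ : StrongDual ℂ M) : Prop :=
  ∃ ξ ξ' : ℕ → H, Summable (fun n => ‖ξ n‖ ^ 2) ∧ Summable (fun n => ‖ξ' n‖ ^ 2) ∧
    ∀ x : M, HasSum (fun n => ⟪ξ n, (x : H →L[ℂ] H) (ξ' n)⟫_ℂ) (φ x)

variable {M} in
theorem IsNormalFunctional.of_equiv {ι : Type*} (e : ℕ ≃ ι) {φ : StrongDual ℂ M} (ξ ξ' : ι → H)
    (h : Summable fun n => ‖ξ n‖ ^ 2) (h' : Summable fun n => ‖ξ' n‖ ^ 2)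
    (hs : ∀ x : M, HasSum (fun n => ⟪ξ n, (x : H →L[ℂ] H) (ξ' n)⟫_ℂ) (φ x)) :
    IsNormalFunctional φ :=
  ⟨fun n => ξ (e n), fun n => ξ' (e n), e.summable_iff.2 h, e.summable_iff.2 h', fun x =>
    (e.hasSum_iff (f := fun n => ⟪ξ n, (x : H →L[ℂ] H) (ξ' n)⟫_ℂ)).2 (hs x)⟩

/-- The predual `M_*`: the space of normal functionals on `M`, with the norm of the dual of `M`. -/
def predual : Submodule ℂ (StrongDual ℂ M) where
  carrier := {φ | IsNormalFunctional φ}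
  zero_mem' := ⟨0, 0, by simp, by simp, fun x => by
    simp only [Pi.zero_apply, map_zero, inner_zero_right]
    exact hasSum_zero⟩
  add_mem' := by
    rintro φ ψ ⟨ξ, ξ', h1, h2, h3⟩ ⟨η, η', h4, h5, h6⟩
    refine IsNormalFunctional.of_equiv Equiv.natSumNatEquivNat.symm (Sum.elim ξ η)
      (Sum.elim ξ' η') (Summable.sum _ h1 h4) (Summable.sum _ h2 h5) fun x => ?_
    exact HasSum.sum (h3 x) (h6 x)
  smul_mem' := by
    rintro c φ ⟨ξ, ξ', h1, h2, h3⟩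
    refine ⟨ξ, fun n => c • ξ' n, h1, ?_, fun x => ?_⟩
    · simpa only [norm_smul, mul_pow] using h2.mul_left (‖c‖ ^ 2)
    · simp only [map_smul, inner_smul_right]
      exact (h3 x).mul_left c

/-- The ultraweak (weak-star) topology `σ(M, M_*)`. -/
abbrev ultraweak : TopologicalSpace M :=
  ⨅ φ : predual M, TopologicalSpace.induced (fun x => (φ : StrongDual ℂ M) x) inferInstance

variable {M}

/-- A linear map between von Neumann algebras is normal if it is ultraweakly continuous. -/
def IsNormalMap (T : M →ₗ[ℂ] N) : Prop := Continuous[ultraweak M, ultraweak N] T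

theorem IsNormalMap.of_predual {T : M →L[ℂ] N}
    (h : ∀ ω ∈ predual N, ω.comp T ∈ predual M) : IsNormalMap T.toLinearMap := by
  refine continuous_iInf_rng.2 fun ω => continuous_induced_rng.2 ?_
  exact continuous_iInf_dom (i := ⟨_, h ω ω.2⟩) continuous_induced_dom

theorem IsNormalMap.comp_mem_predual {T : M →L[ℂ] N} (hT : IsNormalMap T.toLinearMap)
    {ω : StrongDual ℂ N} (hω : ω ∈ predual N) : ω.comp T ∈ predual M := by
  have hc : Continuous[ultraweak M, inferInstance] (ω.comp T).toLinearMap := by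
    have h1 : Continuous[ultraweak N, inferInstance] ω :=
      continuous_iInf_dom (i := ⟨ω, hω⟩) continuous_induced_dom
    exact @Continuous.comp _ _ _ (ultraweak M) (ultraweak N) _ _ _ h1 hT
  have h2 := (LinearMap.mem_span_iff_continuous
    (f := fun φ : predual M => (φ : StrongDual ℂ M).toLinearMap) (ω.comp T).toLinearMap).2 hc
  have h3 : Set.range (fun φ : predual M => (φ : StrongDual ℂ M).toLinearMap) =
      (predual M).map (ContinuousLinearMap.coeLM (R := ℂ) ℂ : StrongDual ℂ M →ₗ[ℂ] (M →ₗ[ℂ] ℂ)) := by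
    ext f
    constructor
    · rintro ⟨φ, rfl⟩; exact ⟨φ, φ.2, rfl⟩
    · rintro ⟨φ, h, rfl⟩; exact ⟨⟨φ, h⟩, rfl⟩
  rw [h3, Submodule.span_eq] at h2
  obtain ⟨φ, hφ, he⟩ := h2
  have : φ = ω.comp T := ContinuousLinearMap.coe_injective he
  exact this ▸ hφ

theorem comp_sliceRight_mem_predual {φ : StrongDual ℂ M} (hφ : φ ∈ predual M)
    {ψ : StrongDual ℂ N} (hψ : ψ ∈ predual N) :
    φ.comp (sliceRight (M := M) ψ) ∈ predual (vnTensor M N) := by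
  obtain ⟨ξ, ξ', h1, h2, h3⟩ := hφ
  obtain ⟨η, η', h4, h5, h6⟩ := hψ
  have hn : ∀ (u : ℕ → H) (v : ℕ → K), Summable (fun n => ‖u n‖ ^ 2) →
      Summable (fun n => ‖v n‖ ^ 2) →
      Summable fun p : ℕ × ℕ => ‖creL K (u p.1) (v p.2)‖ ^ 2 := by
    intro u v hu hv
    have : ∀ p : ℕ × ℕ, ‖creL K (u p.1) (v p.2)‖ ^ 2 = ‖u p.1‖ ^ 2 * ‖v p.2‖ ^ 2 := by
      intro p
      change ‖((u p.1 ⊗ₜ[ℂ] v p.2 : H ⊗[ℂ] K) : HTensor H K)‖ ^ 2 = _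
      rw [UniformSpace.Completion.norm_coe, TensorProduct.norm_tmul, mul_pow]
    simp only [this]
    exact hu.mul_of_nonneg hv (fun _ => by positivity) (fun _ => by positivity)
  refine IsNormalFunctional.of_equiv Nat.pairEquiv.symm
    (fun p => creL K (ξ p.1) (η p.2)) (fun p => creL K (ξ' p.1) (η' p.2))
    (hn ξ η h1 h4) (hn ξ' η' h2 h5) fun y => ?_
  have hsum : Summable fun p : ℕ × ℕ =>
      ⟪creL K (ξ p.1) (η p.2), (y : HTensor H K →L[ℂ] HTensor H K)
        (creL K (ξ' p.1) (η' p.2))⟫_ℂ := by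
    refine Summable.of_norm_bounded
      (((hn ξ η h1 h4).add (hn ξ' η' h2 h5)).mul_left ‖(y : HTensor H K →L[ℂ] HTensor H K)‖)
      fun p => ?_
    refine (norm_inner_le_norm _ _).trans ?_
    have := (y : HTensor H K →L[ℂ] HTensor H K).le_opNorm (creL K (ξ' p.1) (η' p.2))
    set a := ‖creL K (ξ p.1) (η p.2)‖
    set b := ‖creL K (ξ' p.1) (η' p.2)‖
    calc _ ≤ a * (‖(y : HTensor H K →L[ℂ] HTensor H K)‖ * b) := by gcongr
      _ = ‖(y : HTensor H K →L[ℂ] HTensor H K)‖ * (a * b) := by ring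
      _ ≤ _ := by
        gcongr
        nlinarith [sq_nonneg (a - b), sq_nonneg (a + b)]
  have hrow : ∀ n, HasSum (fun m => ⟪creL K (ξ n) (η m), (y : HTensor H K →L[ℂ] HTensor H K)
        (creL K (ξ' n) (η' m))⟫_ℂ) (ψ (compL y (ξ n) (ξ' n))) := by
    intro n
    refine (h6 (compL y (ξ n) (ξ' n))).congr_fun fun m => ?_
    change _ = ⟪η m, adjoint (creL K (ξ n)) _⟫_ℂ
    rw [adjoint_inner_right]
    rfl
  have h7 := h3 (sliceRight ψ y)
  have h8 := hsum.hasSum.prod_fiberwise hrow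
  have h9 := h7.unique (h8.congr_fun fun n => inner_sliceRightOp ψ y (ξ n) (ξ' n))
  rw [comp_apply, h9]
  exact hsum.hasSum

theorem isNormalMap_sliceRight {ψ : StrongDual ℂ N} (hψ : ψ ∈ predual N) :
    IsNormalMap (sliceRight (M := M) ψ).toLinearMap :=
  IsNormalMap.of_predual fun _ hω => comp_sliceRight_mem_predual hω hψ

end predual

section quantum

variable {M : VonNeumannAlgebra H} {N : VonNeumannAlgebra K}

/-- A star homomorphism as a bounded linear map. -/
def starHomL (S : M →⋆ₐ[ℂ] N) : M →L[ℂ] N :=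
  LinearMap.mkContinuous S.toAlgHom.toLinearMap 1 fun x => by
    rw [one_mul]; exact NonUnitalStarAlgHom.norm_apply_le S x

def IsCompletelyPositive (T : M →L[ℂ] M) : Prop := ∃ Φ : M →CP M, ∀ x, Φ x = T x

/-- A map is decomposable if it is a linear combination of completely positive maps. -/
def IsDecomposable (T : M →L[ℂ] M) : Prop :=
  ∃ (n : ℕ) (c : Fin n → ℂ) (Φ : Fin n → (M →CP M)), ∀ x, T x = ∑ k, c k • Φ k x

structure IsFaithfulNormalState (h : StrongDual ℂ M) : Prop where
  normal : h ∈ predual M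
  nonneg : ∀ x : M, 0 ≤ x → 0 ≤ h x
  map_one : h 1 = 1
  faithful : ∀ x : M, 0 ≤ x → h x = 0 → x = 0

/-- A Haar state for `Δ`: a faithful normal state `h` with
`(h ⊗̄ id) Δ x = (id ⊗̄ h) Δ x = h x • 1` for all `x`. -/
structure IsHaarState (Δ : M →⋆ₐ[ℂ] vnTensor M M) (h : StrongDual ℂ M) : Prop
    extends IsFaithfulNormalState h where
  left_invariant : ∀ x, sliceLeft h (Δ x) = h x • (1 : M)
  right_invariant : ∀ x, sliceRight h (Δ x) = h x • (1 : M)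

/-- A von Neumann algebraic compact quantum group with underlying von Neumann algebra `M`:
a normal unital star homomorphism `Δ : M → M ⊗̄ M` such that `(Δ ⊗̄ id) Δ = (id ⊗̄ Δ) Δ` (up to the
canonical identification of the two threefold tensor products) and a Haar state exists. -/
structure CompactQuantumGroup (M : VonNeumannAlgebra H) where
  comul : M →⋆ₐ[ℂ] vnTensor M M
  normal_comul : IsNormalMap (starHomL comul).toLinearMap
  coassoc : ∀ x : M,
    ((assocH H H H).toContinuousLinearEquiv : _ →L[ℂ] _) ∘L ampRight comul (comul x) =
      ampLeft comul (comul x) ∘L ((assocH H H H).toContinuousLinearEquiv : _ →L[ℂ] _)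
  exists_haar : ∃ h : StrongDual ℂ M, IsHaarState comul h

namespace CompactQuantumGroup

variable (G : CompactQuantumGroup M)

/-- The convolution operator `T_φ = (id ⊗̄ φ) Δ`. -/
def convOp (φ : predual M) : M →L[ℂ] M :=
  (sliceRight (φ : StrongDual ℂ M)).comp (starHomL G.comul)

/-- The normal functional `φ ⊗̄ ψ` on `M ⊗̄ N`. -/
def tensorFunctional (φ : predual M) (ψ : predual N) : predual (vnTensor M N) :=
  ⟨(φ : StrongDual ℂ M).comp (sliceRight (ψ : StrongDual ℂ N)),
    comp_sliceRight_mem_predual φ.2 ψ.2⟩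

theorem tensorFunctional_vnTmul (φ : predual M) (ψ : predual N) (a : M) (b : N) :
    (tensorFunctional φ ψ : StrongDual ℂ (vnTensor M N)) (vnTmul M N a b) =
      (φ : StrongDual ℂ M) a * (ψ : StrongDual ℂ N) b := by
  change (φ : StrongDual ℂ M) (sliceRight (ψ : StrongDual ℂ N) (vnTmul M N a b)) = _
  rw [sliceRight_vnTmul, map_smul, smul_eq_mul, mul_comm]

/-- The convolution product `φ ⋆ ψ = (φ ⊗̄ ψ) Δ` on the predual. -/
def conv (φ ψ : predual M) : predual M :=
  ⟨(tensorFunctional φ ψ : StrongDual ℂ (vnTensor M M)).comp (starHomL G.comul),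
    G.normal_comul.comp_mem_predual (tensorFunctional φ ψ).2⟩

end CompactQuantumGroup

end quantum

end VNGroup
end

/-! Everything rests on `φ ⋆ ψ = φ ∘ T_ψ` and on one Fubini identity. For normal `φ`, `ψ` and `y ∈ M
⊗̄ N`, the iterated slices `φ ((id ⊗̄ ψ) y)` and `ψ ((φ ⊗̄ id) y)` are the two orders of summation
of one absolutely convergent double series (`apply_sliceRight_eq_apply_sliceLeft`). Taking `y = Δ x`
gives `ω (T_φ x) = φ ((ω ⊗̄ id) Δ x)`. Invariance of `h` then gives the formula for `h ∘ T_φ`, and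
weak convergence of functionals passes to the operators.

Fubini and coassociativity together give `Δ T_ψ = (id ⊗̄ T_ψ) Δ`, written in slices as
`compL_comul_convOp`; this yields `T_{φ ⋆ ψ} = T_φ T_ψ`, and associativity of `⋆` follows. The norm
estimates hold because slicing by `φ` has norm at most `‖φ‖` and `Δ` is contractive. Normality holds
because `ω ∘ T_φ = ω ⋆ φ` lies in the predual.

For complete positivity, a positive matrix over `M` is `B† B`. Since `Δ` is a star homomorphism,
`T_φ` applied entrywise gives a sum of slices of Gram matrices `(y i† y j)`, whose quadratic form is
`φ` of an operator `S† S` (`sum_inner_sliceRight_star_mul_nonneg`). Positivity of the form gives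
positivity of the matrix by `cstarMatrix_nonneg_of_inner`. Polarization writes a normal functional
through four positive ones, which gives decomposability. -/

noncomputable section

namespace VNGroup

open ContinuousLinearMap

/-! ### Slice maps on `M ⊗̄ N` and the Fubini identity for normal functionals. -/

section slices

variable {H K L : Type*}
  [NormedAddCommGroup H] [InnerProductSpace ℂ H] [CompleteSpace H]
  [NormedAddCommGroup K] [InnerProductSpace ℂ K] [CompleteSpace K]
  [NormedAddCommGroup L] [InnerProductSpace ℂ L] [CompleteSpace L]
  {M : VonNeumannAlgebra H} {N : VonNeumannAlgebra K}

theorem inner_sliceRight (φ : StrongDual ℂ N) (y : vnTensor M N) (ξ ξ' : H) :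
    ⟪ξ, (sliceRight φ y : H →L[ℂ] H) ξ'⟫_ℂ = φ (compL y ξ ξ') :=
  inner_sliceRightOp φ y ξ ξ'

theorem inner_sliceLeft (φ : StrongDual ℂ M) (y : vnTensor M N) (η η' : K) :
    ⟪η, (sliceLeft φ y : K →L[ℂ] K) η'⟫_ℂ = φ (compR y η η') :=
  inner_sliceLeftOp φ y η η'

/-- Together with `inner_compR`, this expresses both partial slices through the same matrix
coefficients of `y` at elementary tensors, so they can be compared. -/
theorem inner_compL (y : vnTensor M N) (ξ ξ' : H) (η η' : K) :
    ⟪η, (compL y ξ ξ' : K →L[ℂ] K) η'⟫_ℂ =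
      ⟪creL K ξ η, (y : HTensor H K →L[ℂ] HTensor H K) (creL K ξ' η')⟫_ℂ :=
  adjoint_inner_right (creL K ξ) _ _

theorem inner_compR (y : vnTensor M N) (ξ ξ' : H) (η η' : K) :
    ⟪ξ, (compR y η η' : H →L[ℂ] H) ξ'⟫_ℂ =
      ⟪creL K ξ η, (y : HTensor H K →L[ℂ] HTensor H K) (creL K ξ' η')⟫_ℂ :=
  adjoint_inner_right (creR H η) _ _

theorem ext_inner_mem {x y : M}
    (h : ∀ ξ ξ' : H, ⟪ξ, (x : H →L[ℂ] H) ξ'⟫_ℂ = ⟪ξ, (y : H →L[ℂ] H) ξ'⟫_ℂ) : x = y :=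
  Subtype.ext <| ContinuousLinearMap.ext fun ξ' => ext_inner_left ℂ fun ξ => h ξ ξ'

/-- Each term is at most `‖T‖ ‖u i‖ ‖v i‖`, and `a b ≤ a ^ 2 + b ^ 2`. -/
theorem summable_inner_apply {ι E : Type*} [NormedAddCommGroup E] [InnerProductSpace ℂ E]
    {u v : ι → E} (hu : Summable fun i => ‖u i‖ ^ 2)
    (hv : Summable fun i => ‖v i‖ ^ 2) (T : E →L[ℂ] E) :
    Summable fun i => ⟪u i, T (v i)⟫_ℂ := by
  refine Summable.of_norm_bounded ((hu.add hv).mul_left ‖T‖) fun i => ?_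
  have h := T.le_opNorm (v i)
  calc ‖⟪u i, T (v i)⟫_ℂ‖ ≤ ‖u i‖ * ‖T (v i)‖ := norm_inner_le_norm _ _
    _ ≤ ‖u i‖ * (‖T‖ * ‖v i‖) := by gcongr
    _ = ‖T‖ * (‖u i‖ * ‖v i‖) := by ring
    _ ≤ _ := by
      gcongr
      nlinarith [sq_nonneg (‖u i‖ - ‖v i‖), sq_nonneg (‖u i‖ + ‖v i‖)]

theorem summable_norm_creL_sq {ι κ : Type*} {u : ι → H} {v : κ → K}
    (hu : Summable fun i => ‖u i‖ ^ 2) (hv : Summable fun k => ‖v k‖ ^ 2) :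
    Summable fun p : ι × κ => ‖creL K (u p.1) (v p.2)‖ ^ 2 := by
  have : ∀ p : ι × κ, ‖creL K (u p.1) (v p.2)‖ ^ 2 = ‖u p.1‖ ^ 2 * ‖v p.2‖ ^ 2 := by
    intro p
    change ‖((u p.1 ⊗ₜ[ℂ] v p.2 : H ⊗[ℂ] K) : HTensor H K)‖ ^ 2 = _
    rw [UniformSpace.Completion.norm_coe, TensorProduct.norm_tmul, mul_pow]
  simp only [this]
  exact hu.mul_of_nonneg hv (fun _ => by positivity) (fun _ => by positivity)

/-- The two iterated slices of an element of `M ⊗̄ N` by normal functionals agree. -/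
theorem apply_sliceRight_eq_apply_sliceLeft {φ : StrongDual ℂ M} (hφ : φ ∈ predual M)
    {ψ : StrongDual ℂ N} (hψ : ψ ∈ predual N) (y : vnTensor M N) :
    φ (sliceRight ψ y) = ψ (sliceLeft φ y) := by
  obtain ⟨ξ, ξ', h1, h2, h3⟩ := hφ
  obtain ⟨η, η', h4, h5, h6⟩ := hψ
  -- Summability over all pairs `(n, m)` is what permits summing by rows and by columns.
  have hsum := summable_inner_apply (summable_norm_creL_sq h1 h4) (summable_norm_creL_sq h2 h5)
    (y : HTensor H K →L[ℂ] HTensor H K)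
  have hrow (n : ℕ) : HasSum (fun m => ⟪creL K (ξ n) (η m), (y : HTensor H K →L[ℂ] HTensor H K)
        (creL K (ξ' n) (η' m))⟫_ℂ) (ψ (compL y (ξ n) (ξ' n))) :=
    (h6 (compL y (ξ n) (ξ' n))).congr_fun fun m => (inner_compL y _ _ _ _).symm
  have hcol (m : ℕ) : HasSum (fun n => ⟪creL K (ξ n) (η m), (y : HTensor H K →L[ℂ] HTensor H K)
        (creL K (ξ' n) (η' m))⟫_ℂ) (φ (compR y (η m) (η' m))) :=
    (h3 (compR y (η m) (η' m))).congr_fun fun n => (inner_compR y _ _ _ _).symm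
  have h7 := (h3 (sliceRight ψ y)).unique
    ((hsum.hasSum.prod_fiberwise hrow).congr_fun fun n => inner_sliceRight ψ y _ _)
  -- The same double sum with the index pair swapped, now summed over `n` first.
  have h8 := (h6 (sliceLeft φ y)).unique
    ((((Equiv.prodComm ℕ ℕ).hasSum_iff.2 hsum.hasSum).prod_fiberwise hcol).congr_fun
      fun m => inner_sliceLeft φ y _ _)
  rw [h7, h8]

theorem sliceRight_one (φ : StrongDual ℂ N) : sliceRight φ (1 : vnTensor M N) = φ 1 • (1 : M) := by
  have : (1 : vnTensor M N) = vnTmul M N 1 1 := Subtype.ext <| HTensor.ext_inner fun ξ ξ' η η' => by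
    change ⟪_, creL K ξ' η'⟫_ℂ = ⟪_, opTensor 1 1 (creL K ξ' η')⟫_ℂ
    rw [opTensor_creL]
    rfl
  rw [this, sliceRight_vnTmul]

theorem norm_sliceRight_le (φ : StrongDual ℂ N) : ‖sliceRight (M := M) φ‖ ≤ ‖φ‖ :=
  LinearMap.mkContinuous_norm_le _ (norm_nonneg _) _

theorem sliceRight_add (φ ψ : StrongDual ℂ N) :
    sliceRight (M := M) (φ + ψ) = sliceRight φ + sliceRight ψ :=
  ContinuousLinearMap.ext fun y => ext_inner_mem fun ξ ξ' => by
    change _ = ⟪ξ, (sliceRight φ y : H →L[ℂ] H) ξ' + (sliceRight ψ y : H →L[ℂ] H) ξ'⟫_ℂ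
    rw [inner_add_right, inner_sliceRight, inner_sliceRight, inner_sliceRight]
    rfl

theorem sliceRight_smul (c : ℂ) (φ : StrongDual ℂ N) :
    sliceRight (M := M) (c • φ) = c • sliceRight φ :=
  ContinuousLinearMap.ext fun y => ext_inner_mem fun ξ ξ' => by
    change _ = ⟪ξ, c • (sliceRight φ y : H →L[ℂ] H) ξ'⟫_ℂ
    rw [inner_smul_right, inner_sliceRight, inner_sliceRight]
    rfl

theorem norm_starHomL_le {P : VonNeumannAlgebra L} (S : M →⋆ₐ[ℂ] P) : ‖starHomL S‖ ≤ 1 :=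
  LinearMap.mkContinuous_norm_le _ zero_le_one _

/-- Vector functionals are normal. -/
theorem vectorFunctional_mem_predual (ξ ξ' : H) :
    ((innerSL ℂ ξ).comp ((ContinuousLinearMap.apply ℂ H ξ').comp
      M.toStarSubalgebra.toSubalgebra.toSubmodule.subtypeL) : StrongDual ℂ M) ∈ predual M := by
  classical
  -- A single vector pair is a square-summable sequence supported at the index `0`.
  refine ⟨Pi.single 0 ξ, Pi.single 0 ξ', ?_, ?_, fun x => ?_⟩
  · exact summable_of_ne_finset_zero (s := {0}) fun n hn => by
      rw [Pi.single_eq_of_ne (by simpa using hn)]; simp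
  · exact summable_of_ne_finset_zero (s := {0}) fun n hn => by
      rw [Pi.single_eq_of_ne (by simpa using hn)]; simp
  · convert hasSum_single (0 : ℕ) fun n hn => ?_ using 1
    · simp; rfl
    · rw [Pi.single_eq_of_ne hn]; simp

end slices

/-! ### The convolution algebra and its representation by convolution operators. -/

namespace CompactQuantumGroup

variable {H : Type*} [NormedAddCommGroup H] [InnerProductSpace ℂ H] [CompleteSpace H]
  {M : VonNeumannAlgebra H} (G : CompactQuantumGroup M)

/-- Definitional, because `φ ⊗̄ ψ` is built as `φ ∘ (id ⊗̄ ψ)`. Properties of `⋆` thereby become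
properties of `T_ψ`. -/
theorem conv_apply (φ ψ : predual M) (x : M) : (G.conv φ ψ).1 x = φ.1 (G.convOp ψ x) := rfl

theorem convOp_apply (φ : predual M) (x : M) : G.convOp φ x = sliceRight φ.1 (G.comul x) := rfl

theorem convOp_add (φ ψ : predual M) : G.convOp (φ + ψ) = G.convOp φ + G.convOp ψ := by
  refine ContinuousLinearMap.ext fun x => ?_
  exact congrArg (fun S => S (G.comul x)) (sliceRight_add (M := M) φ.1 ψ.1)

theorem convOp_smul (c : ℂ) (φ : predual M) : G.convOp (c • φ) = c • G.convOp φ := by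
  refine ContinuousLinearMap.ext fun x => ?_
  exact congrArg (fun S => S (G.comul x)) (sliceRight_smul (M := M) c φ.1)

theorem norm_convOp_le (φ : predual M) : ‖G.convOp φ‖ ≤ ‖φ‖ :=
  calc ‖G.convOp φ‖ ≤ ‖sliceRight (M := M) φ.1‖ * ‖starHomL G.comul‖ := opNorm_comp_le _ _
    _ ≤ ‖φ.1‖ * 1 := by
      gcongr
      · exact norm_sliceRight_le _
      · exact norm_starHomL_le _
    _ = ‖φ‖ := mul_one _

/-- Coassociativity, tested on elementary tensors. -/
theorem inner_comul_compR_eq_inner_comul_compL (x : M) (ξ ξ' η η' ζ ζ' : H) :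
    ⟪creL H ξ η, (G.comul (compR (G.comul x) ζ ζ') : HTensor H H →L[ℂ] HTensor H H)
      (creL H ξ' η')⟫_ℂ =
    ⟪creL H η ζ, (G.comul (compL (G.comul x) ξ ξ') : HTensor H H →L[ℂ] HTensor H H)
      (creL H η' ζ')⟫_ℂ := by
  -- The two sides are matrix coefficients of `(Δ ⊗̄ id) Δ x` and `(id ⊗̄ Δ) Δ x`; the unitary
  -- `assocH` moves the first onto `H ⊗ (H ⊗ H)`.
  rw [← inner_ampRight, ← inner_ampLeft, ← LinearIsometryEquiv.inner_map_map (assocH H H H),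
    assocH_creL]
  congr 1
  have := congrArg (fun T => T (creL H (creL H ξ' η') ζ')) (G.coassoc x)
  refine this.trans ?_
  change ampLeft G.comul (G.comul x) (assocH H H H (creL H (creL H ξ' η') ζ')) = _
  rw [assocH_creL]

/-- This is `Δ T_ψ = (id ⊗̄ T_ψ) Δ`, tested against vector functionals on the first leg; in this
form no extension of `T_ψ` to the tensor product is needed. -/
theorem compL_comul_convOp (ψ : predual M) (x : M) (ξ ξ' : H) :
    compL (G.comul (G.convOp ψ x)) ξ ξ' = G.convOp ψ (compL (G.comul x) ξ ξ') := by
  refine ext_inner_mem fun η η' => ?_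
  rw [inner_compL, convOp_apply, convOp_apply, inner_sliceRight]
  -- Normality of `Δ` enters here: a vector functional composed with `Δ` stays in the predual, so
  -- Fubini applies to it and `ψ`.
  have h1 := G.normal_comul.comp_mem_predual
    (vectorFunctional_mem_predual (M := vnTensor M M) (creL H ξ η) (creL H ξ' η'))
  have h2 := apply_sliceRight_eq_apply_sliceLeft h1 ψ.2 (G.comul x)
  refine h2.trans ?_
  congr 1
  refine ext_inner_mem fun ζ ζ' => ?_
  rw [inner_sliceLeft, inner_compL]
  exact G.inner_comul_compR_eq_inner_comul_compL x ξ ξ' η η' ζ ζ'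

/-- Both matrix coefficients equal `φ (T_ψ ((ω_{ξ,ξ'} ⊗̄ id) Δ x))`: one by `conv_apply`, the other
by moving `T_ψ` past `Δ`. -/
theorem convOp_conv (φ ψ : predual M) : G.convOp (G.conv φ ψ) = (G.convOp φ).comp (G.convOp ψ) := by
  refine ContinuousLinearMap.ext fun x => ext_inner_mem fun ξ ξ' => ?_
  rw [comp_apply, convOp_apply, convOp_apply, inner_sliceRight, inner_sliceRight,
    compL_comul_convOp, conv_apply]

/-- Both sides evaluate at `x` to `φ (T_ψ (T_χ x))`, by multiplicativity of `ψ ↦ T_ψ`. -/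
theorem conv_assoc (φ ψ χ : predual M) : G.conv (G.conv φ ψ) χ = G.conv φ (G.conv ψ χ) :=
  Subtype.ext <| ContinuousLinearMap.ext fun x => by
    rw [conv_apply, conv_apply, conv_apply, convOp_conv, comp_apply]

theorem conv_smul_add_left (c : ℂ) (φ ψ χ : predual M) :
    G.conv (c • φ + ψ) χ = c • G.conv φ χ + G.conv ψ χ := rfl

theorem conv_smul_add_right (c : ℂ) (φ ψ χ : predual M) :
    G.conv χ (c • φ + ψ) = c • G.conv χ φ + G.conv χ ψ :=
  Subtype.ext <| ContinuousLinearMap.ext fun x => by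
    rw [conv_apply, convOp_add, convOp_smul]
    exact (map_add χ.1 _ _).trans (congrArg (· + _) (map_smul χ.1 _ _))

theorem norm_conv_le (φ ψ : predual M) : ‖G.conv φ ψ‖ ≤ ‖φ‖ * ‖ψ‖ :=
  (opNorm_comp_le φ.1 (G.convOp ψ)).trans (by gcongr; exacts [le_rfl, G.norm_convOp_le ψ])

/-- The linear map `φ ↦ T_φ`. -/
def convOpₗ : predual M →ₗ[ℂ] (M →L[ℂ] M) where
  toFun := G.convOp
  map_add' := G.convOp_add
  map_smul' := G.convOp_smul

theorem continuous_convOp : Continuous G.convOp :=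
  AddMonoidHomClass.continuous_of_bound G.convOpₗ 1 fun φ =>
    (G.norm_convOp_le φ).trans_eq (one_mul _).symm

theorem convOp_one (φ : predual M) : G.convOp φ 1 = φ.1 1 • (1 : M) := by
  rw [convOp_apply, map_one, sliceRight_one]

/-- For `ω` in the predual, `ω ∘ T_φ = (ω ⊗̄ φ) Δ` is again in the predual. -/
theorem isNormalMap_convOp (φ : predual M) : IsNormalMap (G.convOp φ).toLinearMap :=
  IsNormalMap.of_predual fun _ hω =>
    G.normal_comul.comp_mem_predual (comp_sliceRight_mem_predual hω φ.2)

/-- Fubini turns `h ((id ⊗̄ φ) Δ x)` into `φ ((h ⊗̄ id) Δ x) = φ (h x • 1)`, so left invariance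
suffices. -/
theorem haar_convOp {h : StrongDual ℂ M} (hh : IsHaarState G.comul h) (φ : predual M) (x : M) :
    h (G.convOp φ x) = φ.1 1 * h x := by
  rw [convOp_apply, apply_sliceRight_eq_apply_sliceLeft hh.normal φ.2, hh.left_invariant, map_smul,
    smul_eq_mul, mul_comm]

theorem tendsto_convOp_ultraweak {ι : Type*} {l : Filter ι} {φi : ι → predual M} {φ : predual M}
    (h : ∀ x : M, Filter.Tendsto (fun i => (φi i).1 x) l (𝓝 (φ.1 x))) (x : M) :
    Filter.Tendsto (fun i => G.convOp (φi i) x) l (@nhds M (ultraweak M) (G.convOp φ x)) := by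
  rw [nhds_iInf, Filter.tendsto_iInf]
  intro ω
  rw [nhds_induced, Filter.tendsto_comap_iff]
  -- The element `(ω ⊗̄ id) Δ x` does not depend on `χ`, so the hypothesis at this one element gives
  -- convergence against `ω`.
  have hω (χ : predual M) : ω.1 (G.convOp χ x) = χ.1 (sliceLeft ω.1 (G.comul x)) :=
    apply_sliceRight_eq_apply_sliceLeft ω.2 χ.2 _
  simpa only [Function.comp_def, hω] using h (sliceLeft ω.1 (G.comul x))

end CompactQuantumGroup

end VNGroup

end

noncomputable section

namespace VNGroup

open ContinuousLinearMap

/-! ### Positivity of matrices over `M`, tested on `H ^ n`. -/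

section cstar

variable {A : Type*} [CStarAlgebra A] [PartialOrder A] [StarOrderedRing A]

theorem exists_eq_star_mul_self {a : A} (ha : 0 ≤ a) : ∃ c : A, a = star c * c :=
  CStarAlgebra.nonneg_iff_eq_star_mul_self.1 ha

/-- The negative part `b` of `a`, with the properties that determine the sign of `a`. -/
theorem exists_negPart {a : A} (ha : IsSelfAdjoint a) :
    ∃ b : A, 0 ≤ b ∧ star b = b ∧ a * b = -(b * b) ∧ (b = 0 → 0 ≤ a) := by
  refine ⟨a⁻, CFC.negPart_nonneg a, (CFC.negPart_nonneg a).isSelfAdjoint.star_eq, ?_,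
    (CFC.negPart_eq_zero_iff a ha).1⟩
  calc a * a⁻ = (a⁺ - a⁻) * a⁻ := by rw [CFC.posPart_sub_negPart a ha]
    _ = -(a⁻ * a⁻) := by rw [sub_mul, CFC.posPart_mul_negPart, zero_sub]

/-- The C*-identity is used twice: `(b * b)† (b * b) = b * b ^ 3 = 0`, and then `b† b = b * b = 0`.
-/
theorem eq_zero_of_cube_eq_zero {b : A} (hb : star b = b) (h : b * (b * b) = 0) : b = 0 := by
  have hsq : b * b = 0 := by
    rw [← CStarRing.star_mul_self_eq_zero_iff, star_mul, hb, mul_assoc, h, mul_zero]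
  rw [← CStarRing.star_mul_self_eq_zero_iff, hb, hsq]

end cstar

section matrices

variable {H : Type*} [NormedAddCommGroup H] [InnerProductSpace ℂ H] [CompleteSpace H]
  {M : VonNeumannAlgebra H} {n : ℕ}

/-- The action of a matrix over `M` on `H ^ n`. -/
def matrixAct (A : CStarMatrix (Fin n) (Fin n) M) :
    PiLp 2 (fun _ : Fin n => H) →ₗ[ℂ] PiLp 2 (fun _ : Fin n => H) where
  toFun v := WithLp.toLp 2 fun i => ∑ j, (A i j : H →L[ℂ] H) (v j)
  map_add' v w := by ext i; simp [Finset.sum_add_distrib]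
  map_smul' c v := by ext i; simp [Finset.smul_sum]

theorem matrixAct_apply (A : CStarMatrix (Fin n) (Fin n) M) (v : PiLp 2 (fun _ : Fin n => H))
    (i : Fin n) : matrixAct A v i = ∑ j, (A i j : H →L[ℂ] H) (v j) := rfl

theorem inner_matrixAct (A : CStarMatrix (Fin n) (Fin n) M) (v w : PiLp 2 (fun _ : Fin n => H)) :
    ⟪v, matrixAct A w⟫_ℂ = ∑ i, ∑ j, ⟪v i, (A i j : H →L[ℂ] H) (w j)⟫_ℂ := by
  simp only [PiLp.inner_apply, matrixAct_apply, inner_sum]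

theorem matrixAct_mul (A B : CStarMatrix (Fin n) (Fin n) M) (v : PiLp 2 (fun _ : Fin n => H)) :
    matrixAct (A * B) v = matrixAct A (matrixAct B v) := by
  ext i
  simp only [matrixAct_apply, map_sum, CStarMatrix.mul_apply]
  rw [Finset.sum_comm]
  refine Finset.sum_congr rfl fun j _ => ?_
  rw [AddSubmonoidClass.coe_finsetSum, sum_apply]
  rfl

theorem matrixAct_zero : matrixAct (0 : CStarMatrix (Fin n) (Fin n) M) = 0 := by
  ext v i
  simp [matrixAct_apply]

theorem matrixAct_neg (A : CStarMatrix (Fin n) (Fin n) M) (v : PiLp 2 (fun _ : Fin n => H)) :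
    matrixAct (-A) v = -matrixAct A v := by
  ext i
  simp [matrixAct_apply]

theorem inner_matrixAct_star (A : CStarMatrix (Fin n) (Fin n) M)
    (v w : PiLp 2 (fun _ : Fin n => H)) :
    ⟪v, matrixAct (star A) w⟫_ℂ = ⟪matrixAct A v, w⟫_ℂ := by
  rw [← inner_conj_symm (matrixAct A v), inner_matrixAct, inner_matrixAct, Finset.sum_comm, map_sum]
  refine Finset.sum_congr rfl fun j _ => ?_
  rw [map_sum]
  refine Finset.sum_congr rfl fun i _ => ?_
  rw [inner_conj_symm, CStarMatrix.star_apply]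
  exact adjoint_inner_right _ _ _

/-- Entries are recovered by acting on vectors supported in one coordinate. Identities in the matrix
algebra can thus be checked on `H ^ n`. -/
theorem matrixAct_injective :
    Function.Injective (matrixAct : CStarMatrix (Fin n) (Fin n) M → _) := fun A B h => by
  refine CStarMatrix.ext fun i j => ext_inner_mem fun ξ ξ' => ?_
  have key (C : CStarMatrix (Fin n) (Fin n) M) :
      matrixAct C (PiLp.single 2 j ξ') i = (C i j : H →L[ℂ] H) ξ' := by
    rw [matrixAct_apply, Finset.sum_eq_single j]
    · simp
    · intro k _ hk
      simp [hk]
    · simp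
  rw [← key A, h, key B]

theorem inner_matrixAct_nonneg {A : CStarMatrix (Fin n) (Fin n) M} (hA : 0 ≤ A)
    (v : PiLp 2 (fun _ : Fin n => H)) : 0 ≤ ⟪v, matrixAct A v⟫_ℂ := by
  obtain ⟨B, rfl⟩ := exists_eq_star_mul_self hA
  rw [matrixAct_mul, inner_matrixAct_star, ← ofReal_norm_sq]
  exact Complex.zero_le_real.2 (by positivity)

/-- A matrix over `M` is positive if its quadratic form on `H ^ n` is. -/
theorem cstarMatrix_nonneg_of_inner {A : CStarMatrix (Fin n) (Fin n) M}
    (h : ∀ v : PiLp 2 (fun _ : Fin n => H), 0 ≤ ⟪v, matrixAct A v⟫_ℂ) : 0 ≤ A := by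
  -- On a complex space, a real-valued quadratic form forces symmetry.
  have hsymm : (matrixAct A).IsSymmetric := by
    refine (LinearMap.isSymmetric_iff_inner_map_self_real _).2 fun v => ?_
    rw [inner_conj_symm]
    have h1 := (Complex.nonneg_iff.1 (h v)).2
    rw [← inner_conj_symm (matrixAct A v)]
    exact (Complex.conj_eq_iff_im.2 h1.symm).symm
  have hA : IsSelfAdjoint A := by
    refine matrixAct_injective (LinearMap.ext fun w => ext_inner_left ℂ fun v => ?_)
    rw [inner_matrixAct_star, hsymm]
  -- With `N` the negative part, `A N = -N ^ 2`. It suffices that `N ^ 3 = 0`, and over `ℂ` this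
  -- follows once its quadratic form vanishes.
  obtain ⟨N, hN, hNs, hNA, hN0⟩ := exists_negPart hA
  refine hN0 (eq_zero_of_cube_eq_zero hNs (matrixAct_injective ?_))
  have hmove (v w : PiLp 2 (fun _ : Fin n => H)) :
      ⟪v, matrixAct N w⟫_ℂ = ⟪matrixAct N v, w⟫_ℂ := by
    rw [← inner_matrixAct_star, hNs]
  rw [matrixAct_zero, ← inner_map_self_eq_zero]
  intro v
  rw [← inner_conj_symm, map_eq_zero]
  refine le_antisymm ?_ ?_
  -- Testing `A` at `N v` gives `0 ≤ -⟪v, N ^ 3 v⟫`; the other bound is positivity of `N` at `N v`.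
  · have h1 := h (matrixAct N v)
    rw [← matrixAct_mul, hNA, matrixAct_neg, inner_neg_right] at h1
    rw [matrixAct_mul, hmove]
    exact neg_nonneg.1 h1
  · rw [matrixAct_mul, hmove, matrixAct_mul]
    exact inner_matrixAct_nonneg hN _

end matrices

/-! ### Slices of Gram matrices by positive functionals. -/

section positivity

variable {H K : Type*}
  [NormedAddCommGroup H] [InnerProductSpace ℂ H] [CompleteSpace H]
  [NormedAddCommGroup K] [InnerProductSpace ℂ K] [CompleteSpace K]
  {M : VonNeumannAlgebra H} {N : VonNeumannAlgebra K}

theorem compL_star_mul (y z : vnTensor M N) (ξ ξ' : H) :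
    (compL (star y * z) ξ ξ' : K →L[ℂ] K) =
      adjoint ((y : HTensor H K →L[ℂ] HTensor H K) ∘L creL K ξ) ∘L
        ((z : HTensor H K →L[ℂ] HTensor H K) ∘L creL K ξ') := by
  rw [adjoint_comp]
  rfl

/-- The matrix `(id ⊗̄ φ) (∑ k, y k i† y k j)` has a positive quadratic form. -/
theorem sum_inner_sliceRight_star_mul_nonneg {φ : StrongDual ℂ N} (hφ : ∀ x : N, 0 ≤ x → 0 ≤ φ x)
    {ι : Type*} [Fintype ι] (y : ι → vnTensor M N) (ξ : ι → H) :
    0 ≤ ∑ i, ∑ j, ⟪ξ i, (sliceRight φ (star (y i) * y j) : H →L[ℂ] H) (ξ j)⟫_ℂ := by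
  simp only [inner_sliceRight, ← map_sum]
  refine hφ _ ?_
  -- The double sum factors as `S† S` with `S η = ∑ i, y i (ξ i ⊗ η)`, an operator from `K` to `H ⊗
  -- K`.
  have hsum : ((∑ i, ∑ j, compL (star (y i) * y j) (ξ i) (ξ j) : N) : K →L[ℂ] K) =
      adjoint (∑ i, (y i : HTensor H K →L[ℂ] HTensor H K) ∘L creL K (ξ i)) ∘L
        ∑ i, (y i : HTensor H K →L[ℂ] HTensor H K) ∘L creL K (ξ i) := by
    rw [map_sum, finsetSum_comp, AddSubmonoidClass.coe_finsetSum]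
    refine Finset.sum_congr rfl fun i _ => ?_
    rw [comp_finsetSum, AddSubmonoidClass.coe_finsetSum]
    exact Finset.sum_congr rfl fun j _ => compL_star_mul _ _ _ _
  change (0 : K →L[ℂ] K) ≤ _
  rw [hsum, ContinuousLinearMap.nonneg_iff_isPositive]
  exact ContinuousLinearMap.isPositive_adjoint_comp_self _

end positivity

/-! ### Decomposition of normal functionals into positive ones. -/

section normal

variable {H : Type*} [NormedAddCommGroup H] [InnerProductSpace ℂ H] [CompleteSpace H]
  {M : VonNeumannAlgebra H}

/-- Square-summable sequences of vectors define positive normal functionals. -/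
theorem exists_positive_normal (ζ : ℕ → H) (hζ : Summable fun n => ‖ζ n‖ ^ 2) :
    ∃ φ : predual M, (∀ x : M, 0 ≤ x → 0 ≤ φ.1 x) ∧
      ∀ x : M, HasSum (fun n => ⟪ζ n, (x : H →L[ℂ] H) (ζ n)⟫_ℂ) (φ.1 x) := by
  have hs (x : M) : Summable fun n => ⟪ζ n, (x : H →L[ℂ] H) (ζ n)⟫_ℂ :=
    summable_inner_apply hζ hζ _
  have hb (x : M) (n : ℕ) :
      ‖⟪ζ n, (x : H →L[ℂ] H) (ζ n)⟫_ℂ‖ ≤ ‖x‖ * ‖ζ n‖ ^ 2 := by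
    have := (x : H →L[ℂ] H).le_opNorm (ζ n)
    calc _ ≤ ‖ζ n‖ * ‖(x : H →L[ℂ] H) (ζ n)‖ := norm_inner_le_norm _ _
      _ ≤ ‖ζ n‖ * (‖(x : H →L[ℂ] H)‖ * ‖ζ n‖) := by gcongr
      _ = ‖x‖ * ‖ζ n‖ ^ 2 := by rw [show ‖x‖ = ‖(x : H →L[ℂ] H)‖ from rfl]; ring
  let f : M →ₗ[ℂ] ℂ :=
    { toFun := fun x => ∑' n, ⟪ζ n, (x : H →L[ℂ] H) (ζ n)⟫_ℂ
      map_add' := fun x y => by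
        rw [← (hs x).tsum_add (hs y)]
        exact tsum_congr fun n => inner_add_right _ _ _
      map_smul' := fun c x => by
        rw [RingHom.id_apply, smul_eq_mul, ← tsum_mul_left]
        exact tsum_congr fun n => inner_smul_right _ _ _ }
  let φ : StrongDual ℂ M := f.mkContinuous (∑' n, ‖ζ n‖ ^ 2) fun x => by
    change ‖∑' n, ⟪ζ n, (x : H →L[ℂ] H) (ζ n)⟫_ℂ‖ ≤ _
    refine (tsum_of_norm_bounded (hζ.mul_left ‖x‖).hasSum (hb x)).trans_eq ?_
    rw [tsum_mul_left, mul_comm]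
  have hφ (x : M) : HasSum (fun n => ⟪ζ n, (x : H →L[ℂ] H) (ζ n)⟫_ℂ) (φ x) := (hs x).hasSum
  refine ⟨⟨φ, ζ, ζ, hζ, hζ, hφ⟩, fun x hx => (hφ x).nonneg fun n => ?_, hφ⟩
  have hx' : (0 : H →L[ℂ] H) ≤ x := hx
  exact ((ContinuousLinearMap.nonneg_iff_isPositive _).1 hx').inner_nonneg_right _

/-- A normal functional is a linear combination of four positive normal functionals. -/
theorem exists_eq_sum_positive (φ : predual M) :
    ∃ (c : Fin 4 → ℂ) (ω : Fin 4 → predual M),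
      (∀ k, ∀ x : M, 0 ≤ x → 0 ≤ (ω k).1 x) ∧ φ = ∑ k, c k • ω k := by
  obtain ⟨φ, ξ, ξ', h1, h2, h3⟩ := φ
  have hsum (c : ℂ) : Summable fun n => ‖ξ n + c • ξ' n‖ ^ 2 := by
    -- The majorant is `‖a + b‖ ^ 2 ≤ 2 ‖a‖ ^ 2 + 2 ‖b‖ ^ 2`.
    refine Summable.of_nonneg_of_le (fun _ => by positivity) (fun n => ?_)
      ((h1.mul_left 2).add (h2.mul_left (2 * ‖c‖ ^ 2)))
    have h := norm_add_le (ξ n) (c • ξ' n)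
    rw [norm_smul] at h
    nlinarith [sq_nonneg (‖ξ n‖ - ‖c‖ * ‖ξ' n‖), norm_nonneg (ξ n + c • ξ' n), norm_nonneg (ξ n),
      mul_nonneg (norm_nonneg c) (norm_nonneg (ξ' n))]
  choose ω hpos hω using fun c : ℂ => exists_positive_normal (M := M) _ (hsum c)
  -- Polarization: `ω c` comes from the vectors `ξ n + c • ξ' n` and has weight `conj c / 4`, for
  -- `c` in `{1, -1, I, -I}`. The sums of `conj c` and of `(conj c) ^ 2` vanish, so only the `⟪ξ n,
  -- x (ξ' n)⟫` terms survive.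
  refine ⟨![1 / 4, -1 / 4, -Complex.I / 4, Complex.I / 4],
    ![ω 1, ω (-1), ω Complex.I, ω (-Complex.I)], ?_, ?_⟩
  · intro k
    fin_cases k <;> exact hpos _
  · refine Subtype.ext (ContinuousLinearMap.ext fun x => ?_)
    simp only [Fin.sum_univ_four, Matrix.cons_val]
    refine (h3 x).unique ?_
    refine (((((hω 1 x).mul_left (1 / 4)).add ((hω (-1) x).mul_left (-1 / 4))).add
      ((hω Complex.I x).mul_left (-Complex.I / 4))).add
      ((hω (-Complex.I) x).mul_left (Complex.I / 4))).congr_fun fun n => ?_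
    simp only [map_add, map_smul, inner_add_left, inner_add_right, inner_smul_left,
      inner_smul_right, map_neg, map_one, Complex.conj_I]
    ring_nf
    simp only [Complex.I_sq]
    ring

end normal

/-! ### Complete positivity and decomposability of convolution operators. -/

namespace CompactQuantumGroup

variable {H : Type*} [NormedAddCommGroup H] [InnerProductSpace ℂ H] [CompleteSpace H]
  {M : VonNeumannAlgebra H} (G : CompactQuantumGroup M)

theorem isCompletelyPositive_convOp {φ : predual M} (hφ : ∀ x : M, 0 ≤ x → 0 ≤ φ.1 x) :
    IsCompletelyPositive (G.convOp φ) := by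
  refine ⟨⟨(G.convOp φ).toLinearMap, fun n A hA => ?_⟩, fun x => rfl⟩
  obtain ⟨B, rfl⟩ := exists_eq_star_mul_self hA
  refine cstarMatrix_nonneg_of_inner fun v => ?_
  -- Multiplicativity of `Δ` turns the entries of `B† B` into sums over `k` of Gram entries of the
  -- `k`-th row of `Δ (B)`.
  have hentry (i j : Fin n) : (star B * B).map (G.convOp φ).toLinearMap i j =
      ∑ k, sliceRight φ.1 (star (G.comul (B k i)) * G.comul (B k j)) := by
    rw [CStarMatrix.map_apply, CStarMatrix.mul_apply, map_sum]
    refine Finset.sum_congr rfl fun k _ => ?_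
    rw [CStarMatrix.star_apply]
    change sliceRight φ.1 (G.comul _) = _
    rw [map_mul, map_star]
  rw [inner_matrixAct]
  simp only [hentry, AddSubmonoidClass.coe_finsetSum, sum_apply, inner_sum]
  -- With `k` outermost, each summand is the quadratic form of one sliced Gram matrix and is
  -- nonnegative on its own.
  have hcomm : ∑ i, ∑ j, ∑ k, ⟪v i, (sliceRight φ.1 (star (G.comul (B k i)) * G.comul (B k j)) :
        H →L[ℂ] H) (v j)⟫_ℂ =
      ∑ k, ∑ i, ∑ j, ⟪v i, (sliceRight φ.1 (star (G.comul (B k i)) * G.comul (B k j)) :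
        H →L[ℂ] H) (v j)⟫_ℂ := by
    rw [Finset.sum_comm]
    conv_rhs => rw [Finset.sum_comm]
    rw [Finset.sum_comm]
    exact Finset.sum_congr rfl fun i _ => Finset.sum_comm
  rw [hcomm]
  exact Finset.sum_nonneg fun k _ =>
    sum_inner_sliceRight_star_mul_nonneg hφ (fun i => G.comul (B k i)) _

/-- Linearity of `φ ↦ T_φ` carries the four-term decomposition of `φ` over to the operators. -/
theorem isDecomposable_convOp (φ : predual M) : IsDecomposable (G.convOp φ) := by
  obtain ⟨c, ω, hω, rfl⟩ := exists_eq_sum_positive φ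
  choose Φ hΦ using fun k => G.isCompletelyPositive_convOp (hω k)
  refine ⟨4, c, Φ, fun x => ?_⟩
  simp only [hΦ]
  change G.convOpₗ (∑ k, c k • ω k) x = _
  rw [map_sum, sum_apply]
  simp only [map_smul]
  rfl

end CompactQuantumGroup

end VNGroup

end

/-- Nets are covered by convergence along an arbitrary filter `l`, and the formula under the Haar
state is asserted for every Haar state of `Δ`. -/
theorem mainTheorem9 {H : Type*} [NormedAddCommGroup H] [InnerProductSpace ℂ H] [CompleteSpace H]
    (M : VonNeumannAlgebra H) (G : VNGroup.CompactQuantumGroup M) {ι : Type*} (l : Filter ι) :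
    -- complete positivity and unitality
    (∀ φ : VNGroup.predual M, (∀ x : M, 0 ≤ x → 0 ≤ φ.1 x) →
      VNGroup.IsCompletelyPositive (G.convOp φ)) ∧
    (∀ φ : VNGroup.predual M, φ.1 1 = 1 → G.convOp φ 1 = 1) ∧
    -- normality and decomposability
    (∀ φ : VNGroup.predual M, VNGroup.IsNormalMap (G.convOp φ).toLinearMap ∧
      VNGroup.IsDecomposable (G.convOp φ)) ∧
    -- contractive homomorphism for the convolution product
    ((∀ φ ψ χ : VNGroup.predual M, G.conv (G.conv φ ψ) χ = G.conv φ (G.conv ψ χ)) ∧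
      (∀ (c : ℂ) (φ ψ χ : VNGroup.predual M),
        G.conv (c • φ + ψ) χ = c • G.conv φ χ + G.conv ψ χ ∧
        G.conv χ (c • φ + ψ) = c • G.conv χ φ + G.conv χ ψ) ∧
      (∀ φ ψ : VNGroup.predual M, ‖G.conv φ ψ‖ ≤ ‖φ‖ * ‖ψ‖) ∧
      ∃ T : VNGroup.predual M →ₗ[ℂ] (M →L[ℂ] M), (∀ φ, T φ = G.convOp φ) ∧
        (∀ φ, ‖T φ‖ ≤ ‖φ‖) ∧
        ∀ φ ψ, T (G.conv φ ψ) = (T φ).comp (T ψ)) ∧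
    -- behaviour under the Haar state
    (∀ h : StrongDual ℂ M, VNGroup.IsHaarState G.comul h →
      ∀ (φ : VNGroup.predual M) (x : M), h (G.convOp φ x) = φ.1 1 * h x) ∧
    -- norm continuity
    (∀ (φi : ι → VNGroup.predual M) (φ : VNGroup.predual M),
      Filter.Tendsto φi l (𝓝 φ) → Filter.Tendsto (fun i => G.convOp (φi i)) l (𝓝 (G.convOp φ))) ∧
    -- pointwise weak-star continuity
    (∀ (φi : ι → VNGroup.predual M) (φ : VNGroup.predual M),
      (∀ x : M, Filter.Tendsto (fun i => (φi i).1 x) l (𝓝 (φ.1 x))) →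
      ∀ x : M, Filter.Tendsto (fun i => G.convOp (φi i) x) l
        (@nhds M (VNGroup.ultraweak M) (G.convOp φ x))) := by
  refine ⟨fun φ hφ => G.isCompletelyPositive_convOp hφ,
    fun φ hφ => by rw [G.convOp_one, hφ, one_smul],
    fun φ => ⟨G.isNormalMap_convOp φ, G.isDecomposable_convOp φ⟩,
    ⟨G.conv_assoc,
      fun c φ ψ χ => ⟨G.conv_smul_add_left c φ ψ χ, G.conv_smul_add_right c φ ψ χ⟩,
      G.norm_conv_le,
      G.convOpₗ, fun _ => rfl, G.norm_convOp_le, G.convOp_conv⟩,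
    fun h hh φ x => G.haar_convOp hh φ x,
    fun φi φ hφ => (G.continuous_convOp.tendsto φ).comp hφ,
    fun φi φ hφ x => G.tendsto_convOp_ultraweak hφ x⟩
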